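/- **Setting.** Let $\mathcal X\subset\mathbb R^d$ be a finite nonempty set, and let $h:\mathcal X\to\mathbb R^m$ be a sample of a Gaussian process with mean function $\mu_0$ and matrix-valued covariance function $K_0$. Let $g_0,\dots,g_n:\mathcal X\times\mathbb R^m\to\mathbb R$ be known functions with $|g_i(x,y)-g_i(x,z)|\le L_i\|y-z\|_1$, and put $f_i(x)=g_i(x,h(x))$. The problem is to maximize $f_0(x)$ over $x\in\mathcal X$ subject to $f_i(x)\ge 0$ for $i=1,\dots,n$. Querying a point $x_{t+1}$ returns $y_{t+1}=h(x_{t+1})+\epsilon_{t+1}$, where the $\epsilon_t$ are i.i.d. $\mathcal N(0,\sigma^2I_m)$ with $\sigma>0$, independent of $h$. Let $\mathcal N(\mu_t(x),\Sigma_t(x))$ be the Gaussian process posterior of $h(x)$ given the first $t$ observations $\mathcal D_t$. For $\delta\in(0,1)$ let $$\alpha_{t}=\frac{6\delta}{\pi^2(t+1)^2(n+1)|\mathcal X|},$$ and let the upper quantile bound $u_{i,t}(x)=\inf\{y: F(y)\ge 1-\alpha_t/2\}$ be the $(1-\alpha_{t}/2)$-quantile of $g_i(x,Y)$, $Y\sim\mathcal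 N(\mu_t(x),\Sigma_t(x))$, with $F$ the distribution function of $g_i(x,Y)$. In iteration $t=0,1,2,\dots$ the algorithm CUQB declares infeasibility and stops if $\max_{x\in\mathcal X}u_{i,t}(x)<0$ for some $i\in\{1,\dots,n\}$. Otherwise it queries a global maximizer $x_{t+1}$ (chosen on the basis of $\mathcal D_t$) of the auxiliary problem $$\max_{x\in\mathcal X}\ u_{0,t}(x)\quad\text{s.t.}\quad u_{i,t}(x)\ge0,\ i=1,\dots,n .$$ For $T\ge1$ let $$\gamma_{j,T}=\max_{a_1,\dots,a_T\in\mathcal X}\tfrac12\log\det\bigl(I+\sigma^{-2}[K_0(a_s,a_{s'})_{jj}]_{s,s'=1}^T\bigr)$$ (repetitions allowed) and $\gamma_T^{\max}=\max_{1\le j\le m}\gamma_{j,T}$. **Theorem.** There is a constant $C>0$, depending only on $m$, $n$, $|\mathcal X|$, $\delta$, $\sigma$, $L_0,\dots,L_n$ and an upper bound $\kappa$ on the prior variances $K_0(x,x)_{jj}$, such that the following holds whenever $\lim_{T\to\infty}\log(T)\,\gamma_T^{\max}/T=0$. With probability at least $1-\delta$, for every $i\in\{1,\dots,n\}$ with $\epsilon:=-\max_{x\in\mathcal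 X}f_i(x)>0$ (so that the problem is infeasible), the number $$\overline T=\min\Bigl\{T\ge2:\ \sqrt{\log(T)\,\gamma_T^{\max}/T}<C\epsilon\Bigr\}$$ exists (is finite), and CUQB declares infeasibility within its first $\overline T$ iterations (that is, in some iteration $t\in\{0,\dots,\overline T-1\}$), provided that the auxiliary problem has a global maximizer in every iteration $t<\overline T$ in which infeasibility has not yet been declared. (For $n=1$ this proviso always holds.) -/

import Mathlib

open MeasureTheory ProbabilityTheory Filter Topology Matrix
open scoped NNReal ENNReal

namespace CUQB

noncomputable section

/-! ### Gaussian process posterior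

`𝒳` is the (finite) set of candidate points, `m` the number of outputs of the unknown function,
`μ₀` the prior mean, `K₀` the matrix-valued prior covariance function, and `σ` the standard
deviation of the observation noise.  Data after `t` queries consist of the query points
`a : Fin t → 𝒳` and the observations `b : Fin t → EuclideanSpace ℝ (Fin m)`. -/

/-- `K + σ² I`, where `K` is the `tm × tm` prior covariance matrix of the `m` outputs at the `t`
query points. -/
def noisyGram {𝒳 : Type*} {m t : ℕ} (K₀ : 𝒳 → 𝒳 → Matrix (Fin m) (Fin m) ℝ) (σ : ℝ)
    (a : Fin t → 𝒳) : Matrix (Fin t × Fin m) (Fin t × Fin m) ℝ :=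
  Matrix.of (fun p q => K₀ (a p.1) (a q.1) p.2 q.2) + σ ^ 2 • (1 : Matrix _ _ ℝ)

/-- The `m × tm` prior cross-covariance between `h(x)` and the outputs at the query points. -/
def crossCov {𝒳 : Type*} {m t : ℕ} (K₀ : 𝒳 → 𝒳 → Matrix (Fin m) (Fin m) ℝ)
    (a : Fin t → 𝒳) (x : 𝒳) : Matrix (Fin m) (Fin t × Fin m) ℝ :=
  Matrix.of fun j q => K₀ x (a q.1) j q.2

/-- Posterior mean `μ_t(x)`. -/
def posteriorMean {𝒳 : Type*} {m t : ℕ} (μ₀ : 𝒳 → EuclideanSpace ℝ (Fin m))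
    (K₀ : 𝒳 → 𝒳 → Matrix (Fin m) (Fin m) ℝ) (σ : ℝ)
    (a : Fin t → 𝒳) (b : Fin t → EuclideanSpace ℝ (Fin m)) (x : 𝒳) :
    EuclideanSpace ℝ (Fin m) :=
  μ₀ x + WithLp.toLp 2
    (crossCov K₀ a x *ᵥ ((noisyGram K₀ σ a)⁻¹ *ᵥ fun p => b p.1 p.2 - μ₀ (a p.1) p.2))

/-- Posterior covariance matrix `Σ_t(x)`. -/
def posteriorCov {𝒳 : Type*} {m t : ℕ} (K₀ : 𝒳 → 𝒳 → Matrix (Fin m) (Fin m) ℝ) (σ : ℝ)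
    (a : Fin t → 𝒳) (x : 𝒳) : Matrix (Fin m) (Fin m) ℝ :=
  K₀ x x - crossCov K₀ a x * (noisyGram K₀ σ a)⁻¹ * (crossCov K₀ a x)ᵀ

/-! ### Quantile bounds -/

/-- The quantile function (generalized inverse CDF) of a probability law `ν` on `ℝ`. -/
def quantile (ν : Measure ℝ) (p : ℝ) : ℝ := sInf {y : ℝ | p ≤ ν.real (Set.Iic y)}

/-- The law of `Y = g_i(x, μ_t(x) + C_t(x) Z)`, that is, of `g_i(x, ·)` under the
posterior `N(μ_t(x), Σ_t(x))`. -/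
def predictiveLaw {𝒳 : Type*} {m t : ℕ} (μ₀ : 𝒳 → EuclideanSpace ℝ (Fin m))
    (K₀ : 𝒳 → 𝒳 → Matrix (Fin m) (Fin m) ℝ) (σ : ℝ)
    (gi : 𝒳 → EuclideanSpace ℝ (Fin m) → ℝ)
    (a : Fin t → 𝒳) (b : Fin t → EuclideanSpace ℝ (Fin m)) (x : 𝒳) : Measure ℝ :=
  (multivariateGaussian (posteriorMean μ₀ K₀ σ a b x) (posteriorCov K₀ σ a x)).map (gi x)

/-- The probability levels `α_{i,t} = 6δ / (π² (t+1)² (n+1) N)`, where `N` is the number of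
candidate points. -/
def level (δ : ℝ) (n N t : ℕ) : ℝ :=
  6 * δ / (Real.pi ^ 2 * ((t : ℝ) + 1) ^ 2 * ((n : ℝ) + 1) * (N : ℝ))

/-- The upper quantile bounds `u_{i,t}(x)`; index `0` is the objective and the indices
`i.succ`, `i : Fin n`, are the constraints. -/
def upperBound {𝒳 : Type*} [Fintype 𝒳] {m n t : ℕ} (μ₀ : 𝒳 → EuclideanSpace ℝ (Fin m))
    (K₀ : 𝒳 → 𝒳 → Matrix (Fin m) (Fin m) ℝ) (σ : ℝ)
    (g : Fin (n + 1) → 𝒳 → EuclideanSpace ℝ (Fin m) → ℝ) (δ : ℝ)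
    (a : Fin t → 𝒳) (b : Fin t → EuclideanSpace ℝ (Fin m)) (i : Fin (n + 1)) (x : 𝒳) : ℝ :=
  quantile (predictiveLaw μ₀ K₀ σ (g i) a b x) (1 - level δ n (Fintype.card 𝒳) t / 2)

/-! ### The two steps of the algorithm, in terms of the current upper bounds `u` -/

/-- The infeasibility test: `max_x u_i(x) < 0` for some constraint `i`. -/
def DeclaresInfeasible {𝒳 : Type*} {n : ℕ} (u : Fin (n + 1) → 𝒳 → ℝ) : Prop :=
  ∃ i : Fin n, (⨆ x, u i.succ x) < 0

/-- The global maximizers of `u_0` subject to `u_i ≥ 0` for all constraints `i`. -/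
def auxSolutions {𝒳 : Type*} {n : ℕ} (u : Fin (n + 1) → 𝒳 → ℝ) : Set 𝒳 :=
  {x | (∀ i : Fin n, 0 ≤ u i.succ x) ∧
    ∀ x', (∀ i : Fin n, 0 ≤ u i.succ x') → u 0 x' ≤ u 0 x}

/-! ### The Gaussian process model and the runs of the algorithm

Queries are indexed so that `x t` is the point queried in iteration `t = 0, 1, 2, …`
(usually written `x_{t+1}`), and `ξ t` is the noise in that query. -/

/-- `h` is a sample of the Gaussian process with mean `μ₀` and covariance `K₀`, and the noise
vectors `ξ 0, ξ 1, …` are i.i.d. `N(0, σ² I_m)` and independent of `h`. -/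
structure IsGPModel {Ω 𝒳 : Type*} [MeasurableSpace Ω] {m : ℕ} (P : Measure Ω)
    (μ₀ : 𝒳 → EuclideanSpace ℝ (Fin m)) (K₀ : 𝒳 → 𝒳 → Matrix (Fin m) (Fin m) ℝ) (σ : ℝ)
    (h : Ω → 𝒳 → EuclideanSpace ℝ (Fin m)) (ξ : ℕ → Ω → EuclideanSpace ℝ (Fin m)) : Prop where
  measurable_h : Measurable h
  gaussian_h : IsGaussianProcess (fun (p : 𝒳 × Fin m) ω => h ω p.1 p.2) P
  mean_h : ∀ x j, ∫ ω, h ω x j ∂P = μ₀ x j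
  cov_h : ∀ x x' j j', cov[fun ω => h ω x j, fun ω => h ω x' j'; P] = K₀ x x' j j'
  measurable_noise : ∀ t, Measurable (ξ t)
  law_noise : ∀ t, P.map (ξ t) = multivariateGaussian 0 (σ ^ 2 • (1 : Matrix (Fin m) (Fin m) ℝ))
  indep_noise : iIndepFun ξ P
  indep_h_noise : IndepFun h (fun ω t => ξ t ω) P

/-- The observation `y = h(x) + ξ` made in iteration `t`. -/
def obs {Ω 𝒳 : Type*} {m : ℕ} (h : Ω → 𝒳 → EuclideanSpace ℝ (Fin m))
    (ξ : ℕ → Ω → EuclideanSpace ℝ (Fin m)) (x : ℕ → Ω → 𝒳) (t : ℕ) (ω : Ω) :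
    EuclideanSpace ℝ (Fin m) :=
  h ω (x t ω) + ξ t ω

/-- The upper quantile bounds available in iteration `t`, computed from the first `t` queries
and observations. -/
def runUpper {Ω 𝒳 : Type*} [Fintype 𝒳] {m n : ℕ} (μ₀ : 𝒳 → EuclideanSpace ℝ (Fin m))
    (K₀ : 𝒳 → 𝒳 → Matrix (Fin m) (Fin m) ℝ) (σ : ℝ)
    (g : Fin (n + 1) → 𝒳 → EuclideanSpace ℝ (Fin m) → ℝ) (δ : ℝ)
    (h : Ω → 𝒳 → EuclideanSpace ℝ (Fin m)) (ξ : ℕ → Ω → EuclideanSpace ℝ (Fin m))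
    (x : ℕ → Ω → 𝒳) (t : ℕ) (ω : Ω) : Fin (n + 1) → 𝒳 → ℝ :=
  upperBound μ₀ K₀ σ g δ (fun s : Fin t => x s ω) (fun s : Fin t => obs h ξ x s ω)

/-- Infeasibility has been declared in none of the iterations `0, …, t`. -/
def Undeclared {Ω 𝒳 : Type*} {n : ℕ} (u : ℕ → Ω → Fin (n + 1) → 𝒳 → ℝ) (t : ℕ) (ω : Ω) : Prop :=
  ∀ s ≤ t, ¬ DeclaresInfeasible (u s ω)

/-- The queries `x` are produced by the algorithm: each query depends only on the earlier
observations, and as long as infeasibility has not been declared it is a global maximizer of the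
auxiliary problem, provided that there is one.  Nothing is required of the (fictitious) queries
after infeasibility has been declared, except that they still depend on past data only. -/
structure IsRun {Ω 𝒳 : Type*} [Fintype 𝒳] [MeasurableSpace 𝒳] {m n : ℕ}
    (μ₀ : 𝒳 → EuclideanSpace ℝ (Fin m))
    (K₀ : 𝒳 → 𝒳 → Matrix (Fin m) (Fin m) ℝ) (σ : ℝ)
    (g : Fin (n + 1) → 𝒳 → EuclideanSpace ℝ (Fin m) → ℝ) (δ : ℝ)
    (h : Ω → 𝒳 → EuclideanSpace ℝ (Fin m)) (ξ : ℕ → Ω → EuclideanSpace ℝ (Fin m))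
    (x : ℕ → Ω → 𝒳) : Prop where
  adapted : ∀ t, Measurable[⨆ s : Fin t, MeasurableSpace.comap (obs h ξ x s) inferInstance] (x t)
  optimal : ∀ t ω, Undeclared (runUpper μ₀ K₀ σ g δ h ξ x) t ω →
    (auxSolutions (runUpper μ₀ K₀ σ g δ h ξ x t ω)).Nonempty →
    x t ω ∈ auxSolutions (runUpper μ₀ K₀ σ g δ h ξ x t ω)

/-! ### Maximum information gain -/

/-- Maximum information gain `γ_{j,T}` of the `j`-th output from `T` noisy measurements: the
maximum is over all choices of `T` sampling points, repetitions allowed. -/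
def infoGain {𝒳 : Type*} {m : ℕ} (K₀ : 𝒳 → 𝒳 → Matrix (Fin m) (Fin m) ℝ) (σ : ℝ)
    (j : Fin m) (T : ℕ) : ℝ :=
  ⨆ a : Fin T → 𝒳, 1 / 2 * Real.log
    (1 + (σ ^ 2)⁻¹ • Matrix.of fun s s' : Fin T => K₀ (a s) (a s') j j).det

/-- `γ_T^max`, the largest of the `γ_{j,T}`. -/
def infoGainMax {𝒳 : Type*} {m : ℕ} (K₀ : 𝒳 → 𝒳 → Matrix (Fin m) (Fin m) ℝ) (σ : ℝ)
    (T : ℕ) : ℝ :=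
  ⨆ j : Fin m, infoGain K₀ σ j T

end

end CUQB

namespace CUQB

/-! ### Gaussian tails and regression -/

/-! While infeasibility is undeclared, every query satisfies `u_{i,t}(x_{t+1}) ≥ 0` although `f_i ≤
-ε` everywhere, so the upper bound overshoots the truth by at least `ε` at each queried point. Such
overshoots cannot persist, because querying reduces posterior uncertainty.

Put `β_t = √(2 log (4(m+1)/α_t))`. With probability at least `1 - δ`, every output of `h` is within
`β_t` posterior standard deviations of the posterior mean, for all times and points
(`measure_iUnion_missEvent_le`). The same Gaussian tail bound, applied to the posterior law, puts
the quantile at most `L_i β_t ∑_j √(Σ_t)_jj` above `g_i` at the posterior mean. So the overshoot is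
at most twice this quantity (`runUpper_sub_le`).

Sum over `t < T`. By Cauchy–Schwarz the standard deviations are controlled by the sum of the
variances, which is a multiple of `γ_T^max` by the chain rule for log-determinants
(`sum_posteriorCov_le`). Since `β_t` is of order `√(log T)`, this gives `ε ≤ R √(log T · γ_T^max /
T)` (`violation_le_of_undeclared`), false at `T̄` once `C R < 1`.

The probabilistic difficulty is that queries depend on past data. No conditional laws are used: for
a fixed design the error of the posterior mean is a regression residual, independent of the
observations, and there are only finitely many designs of length `t` to sum over
(`measure_abs_sub_posteriorMean_gt_le`). -/

lemma hasSubgaussianMGF_of_map_eq_gaussianReal {Ω : Type*} [MeasurableSpace Ω] {P : Measure Ω}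
    {X : Ω → ℝ} (hX : AEMeasurable X P) {v : ℝ≥0} (h : P.map X = gaussianReal 0 v) :
    HasSubgaussianMGF X v P where
  integrable_exp_mul t := by
    have := integrable_exp_mul_gaussianReal (μ := 0) (v := v) t
    rw [← h] at this
    exact (integrable_map_measure (by fun_prop) hX).1 this
  mgf_le t := by simp [mgf_gaussianReal h]

/-- Two-sided Chernoff bound. Measuring deviations in units of `√v` lets it cover degenerate
Gaussians, which occur when a posterior variance vanishes. -/
lemma measure_abs_gt_le {Ω : Type*} [MeasurableSpace Ω] {P : Measure Ω} [IsProbabilityMeasure P]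
    {X : Ω → ℝ} (hX : AEMeasurable X P) {v : ℝ} (hv : 0 ≤ v)
    (h : P.map X = gaussianReal 0 v.toNNReal) {β : ℝ} (hβ : 0 ≤ β) :
    P {ω | β * √v < |X ω|} ≤ ENNReal.ofReal (2 * Real.exp (-β ^ 2 / 2)) := by
  rcases hv.eq_or_lt with rfl | hv
  · have h0 : P.map X {0}ᶜ = 0 := by simp [h]
    rw [Measure.map_apply_of_aemeasurable hX (by measurability)] at h0
    refine (measure_mono_null (fun ω hω => ?_) h0).le.trans zero_le
    simpa using hω
  have hs := hasSubgaussianMGF_of_map_eq_gaussianReal hX h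
  have hexp : -(β * √v) ^ 2 / (2 * v) = -β ^ 2 / 2 := by
    rw [mul_pow, Real.sq_sqrt hv.le]; field_simp
  have h1 := hs.measure_ge_le (ε := β * √v) (by positivity)
  have h2 := hs.neg.measure_ge_le (ε := β * √v) (by positivity)
  rw [Real.coe_toNNReal _ hv.le, hexp] at h1 h2
  have hsub : {ω | β * √v < |X ω|} ⊆ {ω | β * √v ≤ X ω} ∪ {ω | β * √v ≤ (-X) ω} := by
    intro ω hω
    rcases lt_abs.1 (show β * √v < |X ω| from hω) with h | h
    · exact Or.inl h.le
    · exact Or.inr h.le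
  rw [← ofReal_measureReal]
  refine ENNReal.ofReal_le_ofReal ?_
  calc P.real {ω | β * √v < |X ω|}
      ≤ P.real ({ω | β * √v ≤ X ω} ∪ {ω | β * √v ≤ (-X) ω}) := measureReal_mono hsub
    _ ≤ P.real {ω | β * √v ≤ X ω} + P.real {ω | β * √v ≤ (-X) ω} := measureReal_union_le _ _
    _ ≤ 2 * Real.exp (-β ^ 2 / 2) := by linarith

lemma posSemidef_of_covariance {Ω ι : Type*} [Fintype ι] [MeasurableSpace Ω] {P : Measure Ω}
    [IsProbabilityMeasure P] {Z : ι → Ω → ℝ} (hZ : ∀ i, MemLp (Z i) 2 P) :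
    (Matrix.of fun i i' => cov[Z i, Z i'; P]).PosSemidef := by
  classical
  refine Matrix.PosSemidef.of_dotProduct_mulVec_nonneg ?_ fun w => ?_
  · ext i i'
    simp [covariance_comm]
  · have hm : ∀ i, MemLp (fun ω => w i * Z i ω) 2 P := fun i => (hZ i).const_mul _
    have h : star w ⬝ᵥ (Matrix.of fun i i' => cov[Z i, Z i'; P]) *ᵥ w
        = cov[fun ω => ∑ i, w i * Z i ω, fun ω => ∑ i, w i * Z i ω; P] := by
      rw [covariance_fun_sum_fun_sum hm hm]
      simp only [dotProduct, mulVec, Finset.mul_sum, covariance_const_mul_left,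
        covariance_const_mul_right, star_trivial, Matrix.of_apply]
      exact Finset.sum_congr rfl fun i _ => Finset.sum_congr rfl fun i' _ => by ring
    rw [h, covariance_self]
    · exact variance_nonneg _ _
    · exact (memLp_finsetSum Finset.univ fun i _ => hm i).aemeasurable

/-! ### Linear regression of jointly Gaussian vectors -/

section Regression

variable {Ω ι κ : Type*} [Fintype ι] [MeasurableSpace Ω] {P : Measure Ω} {Y : ι → Ω → ℝ} {H : κ → Ω → ℝ}

/-- The residual of the linear regression of `H` on `Y` with coefficients `w`. -/
noncomputable def residual (P : Measure Ω) (H : κ → Ω → ℝ) (Y : ι → Ω → ℝ) (w : Matrix κ ι ℝ)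
    (k : κ) (ω : Ω) : ℝ :=
  H k ω - ∫ ω, H k ω ∂P - ∑ i, w k i * (Y i ω - ∫ ω, Y i ω ∂P)

lemma memLp_two_of_hasGaussianLaw_prod [Fintype κ]
    (hG : HasGaussianLaw (fun ω => ((fun k => H k ω), (fun i => Y i ω))) P) :
    (∀ k, MemLp (H k) 2 P) ∧ ∀ i, MemLp (Y i) 2 P :=
  ⟨fun k => (hG.fst.eval k).memLp_two, fun i => (hG.snd.eval i).memLp_two⟩

lemma hasGaussianLaw_residual_prod [Fintype κ]
    (hG : HasGaussianLaw (fun ω => ((fun k => H k ω), (fun i => Y i ω))) P) (w : Matrix κ ι ℝ) (k : κ) :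
    HasGaussianLaw (fun ω => (residual P H Y w k ω, (fun i => Y i ω))) P := by
  let L : ((κ → ℝ) × (ι → ℝ)) →L[ℝ] ℝ × (ι → ℝ) :=
    { toFun := fun z => (z.1 k - ∑ i, w k i * z.2 i, z.2)
      map_add' := fun z z' => by
        ext
        · simp [mul_add, Finset.sum_add_distrib]; ring
        · simp
      map_smul' := fun c z => by
        ext
        · simp only [Prod.smul_fst, Prod.smul_snd, Pi.smul_apply, smul_eq_mul, RingHom.id_apply,
            mul_sub, Finset.mul_sum]
          congr 1
          exact Finset.sum_congr rfl fun i _ => by ring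
        · simp
      cont := by fun_prop }
  have h1 := hG.map L
  have := h1.isGaussian_map
  have hL := h1.isProbabilityMeasure
  -- The residual is affine in the data: `L` is the linear part and `c` collects the means.
  let c : ℝ × (ι → ℝ) := (-(∫ ω, H k ω ∂P) + ∑ i, w k i * ∫ ω, Y i ω ∂P, 0)
  have h2 : (fun ω => (residual P H Y w k ω, (fun i => Y i ω)))
      = (fun z => z + c) ∘ (L ∘ fun ω => ((fun k => H k ω), (fun i => Y i ω))) := by
    funext ω
    ext
    · simp only [residual, mul_sub, Finset.sum_sub_distrib, Function.comp, L, c,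
        ContinuousLinearMap.coe_mk', LinearMap.coe_mk, AddHom.coe_mk, Prod.fst_add]
      ring
    · simp [L, c]
  constructor
  rw [h2, ← AEMeasurable.map_map_of_aemeasurable (by fun_prop) h1.aemeasurable]
  infer_instance

variable [IsProbabilityMeasure P]

lemma covariance_residual_left (hH : ∀ k, MemLp (H k) 2 P) (hY : ∀ i, MemLp (Y i) 2 P)
    (w : Matrix κ ι ℝ) (k : κ) {Z : Ω → ℝ} (hZ : MemLp Z 2 P) :
    cov[residual P H Y w k, Z; P] = cov[H k, Z; P] - ∑ i, w k i * cov[Y i, Z; P] := by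
  have hY' : ∀ i, MemLp (fun ω => Y i ω - ∫ ω, Y i ω ∂P) 2 P :=
    fun i => (hY i).sub (memLp_const _)
  have hm : ∀ i, MemLp (fun ω => w k i * (Y i ω - ∫ ω, Y i ω ∂P)) 2 P :=
    fun i => (hY' i).const_mul _
  change cov[fun ω => (H k ω - ∫ ω, H k ω ∂P) - ∑ i, w k i * (Y i ω - ∫ ω, Y i ω ∂P), Z; P] = _
  have hH' : MemLp (fun ω => H k ω - ∫ ω, H k ω ∂P) 2 P := (hH k).sub (memLp_const _)
  rw [covariance_fun_sub_left hH' (memLp_finsetSum _ fun i _ => hm i) hZ,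
    covariance_fun_sum_left hm hZ, covariance_sub_const_left ((hH k).integrable (by norm_num))]
  congr 1
  refine Finset.sum_congr rfl fun i _ => ?_
  rw [covariance_const_mul_left, covariance_sub_const_left ((hY i).integrable (by norm_num))]

lemma memLp_residual (hH : ∀ k, MemLp (H k) 2 P) (hY : ∀ i, MemLp (Y i) 2 P)
    (w : Matrix κ ι ℝ) (k : κ) : MemLp (residual P H Y w k) 2 P :=
  ((hH k).sub (memLp_const _)).sub
    (memLp_finsetSum _ fun i _ => ((hY i).sub (memLp_const _)).const_mul _)

lemma integral_residual (hH : ∀ k, MemLp (H k) 2 P) (hY : ∀ i, MemLp (Y i) 2 P)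
    (w : Matrix κ ι ℝ) (k : κ) : ∫ ω, residual P H Y w k ω ∂P = 0 := by
  have hHi : Integrable (H k) P := (hH k).integrable (by norm_num)
  have hYi : ∀ i, Integrable (Y i) P := fun i => (hY i).integrable (by norm_num)
  have hm : ∀ i, Integrable (fun ω => w k i * (Y i ω - ∫ ω, Y i ω ∂P)) P :=
    fun i => ((hYi i).sub (integrable_const _)).const_mul _
  simp only [residual]
  have hHi' : Integrable (fun ω => H k ω - ∫ ω, H k ω ∂P) P := hHi.sub (integrable_const _)
  rw [integral_sub hHi' (integrable_finsetSum _ fun i _ => hm i),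
    integral_sub hHi (integrable_const _), integral_finsetSum _ fun i _ => hm i]
  simp [integral_const_mul, integral_sub (hYi _) (integrable_const _)]

variable [DecidableEq ι]

/-- The coefficients `B A⁻¹` solve the normal equations. -/
lemma covariance_residual_obs (hH : ∀ k, MemLp (H k) 2 P) (hY : ∀ i, MemLp (Y i) 2 P)
    {A : Matrix ι ι ℝ} {B : Matrix κ ι ℝ} (hA : IsUnit A.det)
    (hAc : ∀ i i', cov[Y i, Y i'; P] = A i i') (hBc : ∀ k i, cov[H k, Y i; P] = B k i)
    (k : κ) (i : ι) : cov[residual P H Y (B * A⁻¹) k, Y i; P] = 0 := by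
  rw [covariance_residual_left hH hY _ _ (hY i), hBc]
  simp only [hAc]
  rw [← Matrix.mul_apply, Matrix.mul_assoc, Matrix.nonsing_inv_mul _ hA, Matrix.mul_one, sub_self]

lemma covariance_residual_residual (hH : ∀ k, MemLp (H k) 2 P) (hY : ∀ i, MemLp (Y i) 2 P)
    {A : Matrix ι ι ℝ} {B : Matrix κ ι ℝ} {K : Matrix κ κ ℝ} (hA : IsUnit A.det)
    (hAc : ∀ i i', cov[Y i, Y i'; P] = A i i') (hBc : ∀ k i, cov[H k, Y i; P] = B k i)
    (hKc : ∀ k k', cov[H k, H k'; P] = K k k') (k k' : κ) :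
    cov[residual P H Y (B * A⁻¹) k, residual P H Y (B * A⁻¹) k'; P]
      = (K - B * A⁻¹ * Bᵀ) k k' := by
  rw [covariance_comm, covariance_residual_left hH hY _ _ (memLp_residual hH hY _ _)]
  have h0 : ∀ i, cov[Y i, residual P H Y (B * A⁻¹) k; P] = 0 := fun i => by
    rw [covariance_comm, covariance_residual_obs hH hY hA hAc hBc]
  simp only [h0, mul_zero, Finset.sum_const_zero, sub_zero]
  rw [covariance_comm, covariance_residual_left hH hY _ _ (hH k'), hKc]
  rw [Matrix.sub_apply, Matrix.mul_apply (N := Bᵀ)]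
  simp only [Matrix.transpose_apply]
  congr 1
  refine Finset.sum_congr rfl fun i _ => ?_
  rw [covariance_comm, hBc]

variable [Fintype κ]

/-- Uncorrelated components of a jointly Gaussian vector are independent. -/
lemma indepFun_residual_obs
    (hG : HasGaussianLaw (fun ω => ((fun k => H k ω), (fun i => Y i ω))) P)
    {A : Matrix ι ι ℝ} {B : Matrix κ ι ℝ} (hA : IsUnit A.det)
    (hAc : ∀ i i', cov[Y i, Y i'; P] = A i i') (hBc : ∀ k i, cov[H k, Y i; P] = B k i) (k : κ) :
    IndepFun (residual P H Y (B * A⁻¹) k) (fun ω i => Y i ω) P := by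
  obtain ⟨hH, hY⟩ := memLp_two_of_hasGaussianLaw_prod hG
  -- The independence criterion speaks of families of coordinates, so the residual becomes a family
  -- indexed by `Unit`.
  let L : (ℝ × (ι → ℝ)) →L[ℝ] (Unit → ℝ) × (ι → ℝ) :=
    { toFun := fun z => (fun _ => z.1, z.2)
      map_add' := fun z z' => rfl
      map_smul' := fun c z => rfl
      cont := by fun_prop }
  have h := HasGaussianLaw.indepFun_of_covariance_eval
    (X := fun _ : Unit => residual P H Y (B * A⁻¹) k) (Y := Y)
    ((hasGaussianLaw_residual_prod hG (B * A⁻¹) k).map_fun L)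
    (fun _ i => covariance_residual_obs hH hY hA hAc hBc k i)
  exact h.comp (measurable_pi_apply ()) measurable_id

lemma measure_abs_residual_gt_le
    (hG : HasGaussianLaw (fun ω => ((fun k => H k ω), (fun i => Y i ω))) P)
    {A : Matrix ι ι ℝ} {B : Matrix κ ι ℝ} {K : Matrix κ κ ℝ} (hA : IsUnit A.det)
    (hAc : ∀ i i', cov[Y i, Y i'; P] = A i i') (hBc : ∀ k i, cov[H k, Y i; P] = B k i)
    (hKc : ∀ k k', cov[H k, H k'; P] = K k k') (k : κ) {β : ℝ} (hβ : 0 ≤ β) :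
    P {ω | β * √((K - B * A⁻¹ * Bᵀ) k k) < |residual P H Y (B * A⁻¹) k ω|}
      ≤ ENNReal.ofReal (2 * Real.exp (-β ^ 2 / 2)) := by
  obtain ⟨hH, hY⟩ := memLp_two_of_hasGaussianLaw_prod hG
  have hR := (hasGaussianLaw_residual_prod hG (B * A⁻¹) k).fst
  have hvar : Var[residual P H Y (B * A⁻¹) k; P] = (K - B * A⁻¹ * Bᵀ) k k := by
    rw [← covariance_self hR.aemeasurable, covariance_residual_residual hH hY hA hAc hBc hKc]
  rw [← hvar]
  refine measure_abs_gt_le hR.aemeasurable (variance_nonneg _ _) ?_ hβ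
  rw [hR.map_eq_gaussianReal, integral_residual hH hY]

end Regression

/-! ### The model at a fixed design, and adaptive designs -/

section Model

variable {Ω 𝒳 : Type*} [MeasurableSpace Ω] {P : Measure Ω} [IsProbabilityMeasure P] {m : ℕ}
  {μ₀ : 𝒳 → EuclideanSpace ℝ (Fin m)} {K₀ : 𝒳 → 𝒳 → Matrix (Fin m) (Fin m) ℝ} {σ : ℝ}
  {h : Ω → 𝒳 → EuclideanSpace ℝ (Fin m)} {ξ : ℕ → Ω → EuclideanSpace ℝ (Fin m)}

/-- Coordinates of the observations at a fixed design `a`. -/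
noncomputable def designObs (h : Ω → 𝒳 → EuclideanSpace ℝ (Fin m))
    (ξ : ℕ → Ω → EuclideanSpace ℝ (Fin m)) {t : ℕ} (a : Fin t → 𝒳) (p : Fin t × Fin m)
    (ω : Ω) : ℝ :=
  h ω (a p.1) p.2 + ξ p.1 ω p.2

omit [IsProbabilityMeasure P] in
lemma IsGPModel.memLp_h (hM : IsGPModel P μ₀ K₀ σ h ξ) (x : 𝒳) (j : Fin m) :
    MemLp (fun ω => h ω x j) 2 P :=
  (hM.gaussian_h.hasGaussianLaw_eval (x, j)).memLp_two

omit [IsProbabilityMeasure P] in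
lemma IsGPModel.hasGaussianLaw_noise (hM : IsGPModel P μ₀ K₀ σ h ξ) (s : ℕ) :
    HasGaussianLaw (ξ s) P :=
  ⟨by rw [hM.law_noise s]; infer_instance⟩

lemma posSemidef_noiseCov (m : ℕ) (σ : ℝ) :
    (σ ^ 2 • (1 : Matrix (Fin m) (Fin m) ℝ)).PosSemidef :=
  Matrix.PosSemidef.one.smul (sq_nonneg σ)

omit [IsProbabilityMeasure P] in
lemma IsGPModel.memLp_noise (hM : IsGPModel P μ₀ K₀ σ h ξ) (s : ℕ) (j : Fin m) :
    MemLp (fun ω => ξ s ω j) 2 P :=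
  ((hM.hasGaussianLaw_noise s).map_fun (EuclideanSpace.proj j)).memLp_two

omit [IsProbabilityMeasure P] in
lemma IsGPModel.integral_noise (hM : IsGPModel P μ₀ K₀ σ h ξ) (s : ℕ) (j : Fin m) :
    ∫ ω, ξ s ω j ∂P = 0 := by
  have hi : Integrable (fun y : EuclideanSpace ℝ (Fin m) => y)
      (multivariateGaussian 0 (σ ^ 2 • (1 : Matrix (Fin m) (Fin m) ℝ))) :=
    IsGaussian.integrable_id
  have h1 := (EuclideanSpace.proj (𝕜 := ℝ) j : EuclideanSpace ℝ (Fin m) →L[ℝ] ℝ).integral_comp_comm hi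
  rw [integral_id_multivariateGaussian, ← hM.law_noise s,
    integral_map (hM.measurable_noise s).aemeasurable (by fun_prop)] at h1
  simpa using h1

omit [IsProbabilityMeasure P] in
lemma IsGPModel.covariance_noise (hM : IsGPModel P μ₀ K₀ σ h ξ) (s s' : ℕ) (j j' : Fin m) :
    cov[fun ω => ξ s ω j, fun ω => ξ s' ω j'; P] = if s = s' ∧ j = j' then σ ^ 2 else 0 := by
  by_cases hs : s = s'
  · subst hs
    have h1 := covariance_eval_multivariateGaussian (μ := 0) (posSemidef_noiseCov m σ) j j'
    rw [← hM.law_noise s, covariance_map_fun (by fun_prop) (by fun_prop)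
      (hM.measurable_noise s).aemeasurable] at h1
    rw [h1]
    simp [Matrix.one_apply]
  · rw [if_neg (fun h => hs h.1)]
    have hi := (hM.indep_noise.indepFun hs).comp
      (φ := fun y : EuclideanSpace ℝ (Fin m) => y j) (ψ := fun y : EuclideanSpace ℝ (Fin m) => y j')
      (by fun_prop) (by fun_prop)
    exact hi.covariance_eq_zero (hM.memLp_noise s j) (hM.memLp_noise s' j')

omit [IsProbabilityMeasure P] in
lemma IsGPModel.covariance_h_noise (hM : IsGPModel P μ₀ K₀ σ h ξ) (x : 𝒳) (s : ℕ) (j j' : Fin m) :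
    cov[fun ω => h ω x j, fun ω => ξ s ω j'; P] = 0 := by
  have hi := hM.indep_h_noise.comp (φ := fun u : 𝒳 → EuclideanSpace ℝ (Fin m) => u x j)
    (ψ := fun v : ℕ → EuclideanSpace ℝ (Fin m) => v s j') (by fun_prop) (by fun_prop)
  exact hi.covariance_eq_zero (hM.memLp_h x j) (hM.memLp_noise s j')

variable {t : ℕ} (a : Fin t → 𝒳)

omit [IsProbabilityMeasure P] in
lemma IsGPModel.memLp_designObs (hM : IsGPModel P μ₀ K₀ σ h ξ) (p : Fin t × Fin m) :
    MemLp (designObs h ξ a p) 2 P :=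
  (hM.memLp_h _ _).add (hM.memLp_noise _ _)

lemma IsGPModel.integral_designObs (hM : IsGPModel P μ₀ K₀ σ h ξ) (p : Fin t × Fin m) :
    ∫ ω, designObs h ξ a p ω ∂P = μ₀ (a p.1) p.2 := by
  simp only [designObs]
  rw [integral_add ((hM.memLp_h _ _).integrable (by norm_num))
    ((hM.memLp_noise _ _).integrable (by norm_num)), hM.mean_h, hM.integral_noise, add_zero]

lemma IsGPModel.covariance_h_designObs (hM : IsGPModel P μ₀ K₀ σ h ξ) (x : 𝒳) (j : Fin m)
    (p : Fin t × Fin m) :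
    cov[fun ω => h ω x j, designObs h ξ a p; P] = crossCov K₀ a x j p := by
  change cov[fun ω => h ω x j, (fun ω => h ω (a p.1) p.2) + fun ω => ξ p.1 ω p.2; P] = _
  rw [covariance_add_right (hM.memLp_h _ _) (hM.memLp_h _ _) (hM.memLp_noise _ _), hM.cov_h,
    hM.covariance_h_noise, add_zero]
  rfl

lemma IsGPModel.covariance_designObs (hM : IsGPModel P μ₀ K₀ σ h ξ) (p q : Fin t × Fin m) :
    cov[designObs h ξ a p, designObs h ξ a q; P] = noisyGram K₀ σ a p q := by
  change cov[(fun ω => h ω (a p.1) p.2) + fun ω => ξ p.1 ω p.2, designObs h ξ a q; P] = _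
  rw [covariance_add_left (hM.memLp_h _ _) (hM.memLp_noise _ _) (hM.memLp_designObs a q),
    hM.covariance_h_designObs]
  change _ + cov[fun ω => ξ p.1 ω p.2, (fun ω => h ω (a q.1) q.2) + fun ω => ξ q.1 ω q.2; P] = _
  rw [covariance_add_right (hM.memLp_noise _ _) (hM.memLp_h _ _) (hM.memLp_noise _ _),
    covariance_comm, hM.covariance_h_noise, hM.covariance_noise, zero_add]
  obtain ⟨p1, p2⟩ := p
  obtain ⟨q1, q2⟩ := q
  simp [noisyGram, crossCov, Matrix.one_apply, Fin.ext_iff]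

lemma IsGPModel.posDef_noisyGram (hM : IsGPModel P μ₀ K₀ σ h ξ) (hσ : 0 < σ) :
    (noisyGram K₀ σ a).PosDef := by
  refine Matrix.PosDef.posSemidef_add ?_ (Matrix.PosDef.one.smul (by positivity))
  have := posSemidef_of_covariance (P := P)
    (Z := fun (p : Fin t × Fin m) ω => h ω (a p.1) p.2) fun p => hM.memLp_h _ _
  simpa only [hM.cov_h] using this

lemma IsGPModel.isUnit_det_noisyGram (hM : IsGPModel P μ₀ K₀ σ h ξ) (hσ : 0 < σ) :
    IsUnit (noisyGram K₀ σ a).det :=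
  (hM.posDef_noisyGram a hσ).det_pos.ne'.isUnit

omit [IsProbabilityMeasure P] in
lemma IsGPModel.hasGaussianLaw_h_designObs [Fintype 𝒳] (hM : IsGPModel P μ₀ K₀ σ h ξ) (x : 𝒳) :
    HasGaussianLaw (fun ω => ((fun j => h ω x j), fun p => designObs h ξ a p ω)) P := by
  have h1 : HasGaussianLaw (fun ω (q : 𝒳 × Fin m) => h ω q.1 q.2) P := by
    let L : (↥(Finset.univ : Finset (𝒳 × Fin m)) → ℝ) →L[ℝ] (𝒳 × Fin m → ℝ) :=
      { toFun := fun u q => u ⟨q, Finset.mem_univ q⟩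
        map_add' := fun _ _ => rfl
        map_smul' := fun _ _ => rfl
        cont := by fun_prop }
    exact (hM.gaussian_h.hasGaussianLaw Finset.univ).map_fun L
  have h2 : HasGaussianLaw (fun ω (s : Fin t) => ξ s ω) P :=
    iIndepFun.hasGaussianLaw (fun s : Fin t => hM.hasGaussianLaw_noise s)
      (hM.indep_noise.precomp Fin.val_injective)
  have h3 : IndepFun (fun ω (q : 𝒳 × Fin m) => h ω q.1 q.2) (fun ω (s : Fin t) => ξ s ω) P :=
    hM.indep_h_noise.comp (φ := fun (u : 𝒳 → EuclideanSpace ℝ (Fin m)) (q : 𝒳 × Fin m) => u q.1 q.2)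
      (ψ := fun (v : ℕ → EuclideanSpace ℝ (Fin m)) (s : Fin t) => v s) (by fun_prop) (by fun_prop)
  let L : ((𝒳 × Fin m → ℝ) × (Fin t → EuclideanSpace ℝ (Fin m))) →L[ℝ]
      (Fin m → ℝ) × (Fin t × Fin m → ℝ) :=
    { toFun := fun z => (fun j => z.1 (x, j), fun p => z.1 (a p.1, p.2) + z.2 p.1 p.2)
      map_add' := fun z z' => by
        ext
        · simp
        · simp; ring
      map_smul' := fun c z => by
        ext
        · simp
        · simp; ring
      cont := by fun_prop }
  exact (h3.hasGaussianLaw h1 h2).map_fun L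

/-- This links the explicit posterior formulas to probability: the error of the posterior mean is a
regression residual, and the posterior covariance is that residual's covariance. -/
lemma IsGPModel.residual_eq (hM : IsGPModel P μ₀ K₀ σ h ξ) (x : 𝒳) (j : Fin m) (ω : Ω) :
    residual P (fun j ω => h ω x j) (designObs h ξ a) (crossCov K₀ a x * (noisyGram K₀ σ a)⁻¹) j ω
      = h ω x j - posteriorMean μ₀ K₀ σ a (fun s => h ω (a s) + ξ s ω) x j := by
  simp only [residual, hM.mean_h, hM.integral_designObs]
  simp only [posteriorMean, PiLp.add_apply, Matrix.mulVec_mulVec, sub_sub]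
  rfl

lemma IsGPModel.posSemidef_posteriorCov [Fintype 𝒳] (hM : IsGPModel P μ₀ K₀ σ h ξ) (hσ : 0 < σ)
    (x : 𝒳) : (posteriorCov K₀ σ a x).PosSemidef := by
  have hH := fun j => hM.memLp_h x j
  have := posSemidef_of_covariance (P := P) fun j => memLp_residual hH (hM.memLp_designObs a)
    (crossCov K₀ a x * (noisyGram K₀ σ a)⁻¹) j
  simp_rw [covariance_residual_residual hH (hM.memLp_designObs a) (hM.isUnit_det_noisyGram a hσ)
    (hM.covariance_designObs a) (hM.covariance_h_designObs a x) (hM.cov_h x x)] at this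
  exact this

/-! ### Adaptive queries -/

section Design

variable [Fintype 𝒳] [MeasurableSpace 𝒳] [MeasurableSingletonClass 𝒳] {x : ℕ → Ω → 𝒳}

omit [MeasurableSpace Ω] [IsProbabilityMeasure P] [Fintype 𝒳] in
/-- The event that the first `s` adaptive queries follow the design `a` is determined by the
observations at the design `a`. -/
lemma measurableSet_queries_eq
    (hx : ∀ t, Measurable[⨆ s : Fin t, MeasurableSpace.comap (obs h ξ x s) inferInstance] (x t))
    (r : ℕ) (hr : r ≤ t) :
    MeasurableSet[MeasurableSpace.comap (fun ω (s : Fin t) => h ω (a s) + ξ s ω) inferInstance]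
      {ω | ∀ s : Fin t, (s : ℕ) < r → x s ω = a s} := by
  induction r with
  | zero => simp
  | succ r ih =>
    have hrt : r < t := hr
    let q : Fin t := ⟨r, hrt⟩
    have hms : MeasurableSet[⨆ s : Fin r, MeasurableSpace.comap (obs h ξ x s) inferInstance]
        (x r ⁻¹' {a q}) := hx r (measurableSet_singleton _)
    have hsup : (⨆ s : Fin r, MeasurableSpace.comap (obs h ξ x s) inferInstance)
        = MeasurableSpace.comap (fun ω (s : Fin r) => obs h ξ x s ω) inferInstance := by
      simp only [MeasurableSpace.pi, MeasurableSpace.comap_iSup, MeasurableSpace.comap_comp]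
      rfl
    rw [hsup] at hms
    obtain ⟨D, hD, hDx⟩ := hms
    have heq : {ω | ∀ s : Fin t, (s : ℕ) < r + 1 → x s ω = a s}
        = {ω | ∀ s : Fin t, (s : ℕ) < r → x s ω = a s} ∩
          (fun ω (s : Fin t) => h ω (a s) + ξ s ω) ⁻¹'
            ((fun (v : Fin t → EuclideanSpace ℝ (Fin m)) (s : Fin r) =>
              v (Fin.castLE hrt.le s)) ⁻¹' D) := by
      ext ω
      -- If the first `r` queries agree with `a`, the data on which query `r` depends are the
      -- observations at `a`.
      have key : (∀ s : Fin t, (s : ℕ) < r → x s ω = a s) →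
          (x r ω = a q ↔ (fun s : Fin r => h ω (a (Fin.castLE hrt.le s)) + ξ s ω) ∈ D) := by
        intro hω
        have h1 : (fun s : Fin r => h ω (a (Fin.castLE hrt.le s)) + ξ s ω)
            = fun s : Fin r => obs h ξ x s ω := by
          funext s
          rw [obs, ← hω (Fin.castLE hrt.le s) s.2]
          rfl
        rw [h1]
        exact (Set.ext_iff.1 hDx ω).symm
      constructor
      · intro hω
        have h2 : ∀ s : Fin t, (s : ℕ) < r → x s ω = a s := fun s hs => hω s (by omega)
        exact ⟨h2, (key h2).1 (hω q (Nat.lt_succ_self r))⟩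
      · rintro ⟨h2, h3⟩ s hs
        rcases Nat.lt_succ_iff_lt_or_eq.1 hs with h4 | h4
        · exact h2 s h4
        · obtain rfl : s = q := Fin.ext h4
          exact (key h2).2 h3
    rw [heq]
    refine (ih hrt.le).inter ⟨_, ?_, rfl⟩
    exact hD.preimage (by fun_prop)

/-- Under an adaptive design the posterior is calibrated: the error of the posterior mean has
Gaussian tails at the scale of the posterior standard deviation. -/
lemma measure_abs_sub_posteriorMean_gt_le (hM : IsGPModel P μ₀ K₀ σ h ξ) (hσ : 0 < σ)
    (hx : ∀ t, Measurable[⨆ s : Fin t, MeasurableSpace.comap (obs h ξ x s) inferInstance] (x t))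
    (t : ℕ) (z : 𝒳) (j : Fin m) {β : ℝ} (hβ : 0 ≤ β) :
    P {ω | β * √(posteriorCov K₀ σ (fun s : Fin t => x s ω) z j j) <
        |h ω z j - posteriorMean μ₀ K₀ σ (fun s : Fin t => x s ω)
          (fun s : Fin t => obs h ξ x s ω) z j|}
      ≤ ENNReal.ofReal (2 * Real.exp (-β ^ 2 / 2)) := by
  classical
  let E : (Fin t → 𝒳) → Set Ω := fun a =>
    {ω | β * √(posteriorCov K₀ σ a z j j) <
      |residual P (fun j ω => h ω z j) (designObs h ξ a)
        (crossCov K₀ a z * (noisyGram K₀ σ a)⁻¹) j ω|}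
  let S : (Fin t → 𝒳) → Set Ω := fun a => {ω | ∀ s : Fin t, (s : ℕ) < t → x s ω = a s}
  have hSm' := fun a : Fin t → 𝒳 => measurableSet_queries_eq (h := h) (ξ := ξ) a hx t le_rfl
  have hobs : ∀ a : Fin t → 𝒳, Measurable (fun ω (s : Fin t) => h ω (a s) + ξ s ω) := fun a =>
    measurable_pi_lambda _ fun s =>
      ((measurable_pi_apply (a s)).comp hM.measurable_h).add (hM.measurable_noise s)
  have hSm : ∀ a, MeasurableSet (S a) := fun a => (hobs a).comap_le _ (hSm' a)
  have hcover : {ω | β * √(posteriorCov K₀ σ (fun s : Fin t => x s ω) z j j) <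
      |h ω z j - posteriorMean μ₀ K₀ σ (fun s : Fin t => x s ω)
        (fun s : Fin t => obs h ξ x s ω) z j|} ⊆ ⋃ a, E a ∩ S a := by
    intro ω hω
    refine Set.mem_iUnion.2 ⟨fun s => x s ω, ?_, fun s _ => rfl⟩
    simp only [E, Set.mem_ofPred_eq, hM.residual_eq]
    exact hω
  -- `E a` concerns the residual at design `a`, while `S a` is determined by the observations at
  -- `a`.
  have hindep : ∀ a, P (E a ∩ S a) = P (E a) * P (S a) := by
    intro a
    have hi := indepFun_residual_obs (hM.hasGaussianLaw_h_designObs a z)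
      (hM.isUnit_det_noisyGram a hσ) (hM.covariance_designObs a) (hM.covariance_h_designObs a z) j
    have hi' := hi.comp (φ := fun r : ℝ => r)
      (ψ := fun (u : Fin t × Fin m → ℝ) (s : Fin t) => WithLp.toLp 2 fun j => u (s, j))
      measurable_id (by fun_prop)
    obtain ⟨D, hD, hDS⟩ := hSm' a
    have hSD : S a = ((fun (u : Fin t × Fin m → ℝ) (s : Fin t) => WithLp.toLp 2 fun j => u (s, j))
        ∘ fun ω p => designObs h ξ a p ω) ⁻¹' D := hDS.symm
    rw [hSD]
    exact hi'.measure_inter_preimage_eq_mul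
      {r : ℝ | β * √(posteriorCov K₀ σ a z j j) < |r|} D
      (measurableSet_lt measurable_const (by fun_prop)) hD
  -- The run follows exactly one design, so the weights `P (S a)` sum to at most one and the union
  -- over designs costs no extra factor.
  have hdisj : Pairwise fun a a' => Disjoint (S a) (S a') := by
    intro a a' hne
    refine Set.disjoint_left.2 fun ω h1 h2 => hne ?_
    funext s
    rw [← h1 s s.2, h2 s s.2]
  calc _ ≤ P (⋃ a, E a ∩ S a) := measure_mono hcover
    _ ≤ ∑ a, P (E a ∩ S a) := measure_iUnion_fintype_le _ _
    _ ≤ ∑ a, ENNReal.ofReal (2 * Real.exp (-β ^ 2 / 2)) * P (S a) := by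
        refine Finset.sum_le_sum fun a _ => ?_
        rw [hindep]
        gcongr
        exact measure_abs_residual_gt_le (hM.hasGaussianLaw_h_designObs a z)
          (hM.isUnit_det_noisyGram a hσ) (hM.covariance_designObs a)
          (hM.covariance_h_designObs a z) (hM.cov_h z z) j hβ
    _ = ENNReal.ofReal (2 * Real.exp (-β ^ 2 / 2)) * P (⋃ a, S a) := by
        rw [← Finset.mul_sum, measure_iUnion hdisj hSm, tsum_fintype]
    _ ≤ ENNReal.ofReal (2 * Real.exp (-β ^ 2 / 2)) := mul_le_of_le_one_right' prob_le_one

end Design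

end Model

/-! ### Posterior variances and information gain -/

/-- Completing the square: `⟨k, A⁻¹ k⟩` dominates `2⟨w, k⟩ - ⟨w, A w⟩`. -/
lemma two_mul_dotProduct_sub_le {ι : Type*} [Fintype ι] [DecidableEq ι] {A : Matrix ι ι ℝ}
    (hA : A.PosDef) (k w : ι → ℝ) :
    2 * (w ⬝ᵥ k) - w ⬝ᵥ (A *ᵥ w) ≤ k ⬝ᵥ (A⁻¹ *ᵥ k) := by
  have hdet : IsUnit A.det := hA.det_pos.ne'.isUnit
  have hAk : A *ᵥ (A⁻¹ *ᵥ k) = k := by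
    rw [Matrix.mulVec_mulVec, Matrix.mul_nonsing_inv _ hdet, Matrix.one_mulVec]
  have hsymm : (A⁻¹ *ᵥ k) ⬝ᵥ (A *ᵥ w) = k ⬝ᵥ w := by
    rw [Matrix.dotProduct_mulVec, ← Matrix.mulVec_transpose]
    have : Aᵀ = A := by simpa using hA.isHermitian.eq
    rw [this, hAk]
  have h0 := hA.posSemidef.dotProduct_mulVec_nonneg (w - A⁻¹ *ᵥ k)
  rw [star_trivial, Matrix.mulVec_sub, hAk, sub_dotProduct, dotProduct_sub, dotProduct_sub, hsymm,
    dotProduct_comm k w, dotProduct_comm (A⁻¹ *ᵥ k) k] at h0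
  linarith

/-! ### Chain rule for the information gain of a scalar kernel -/

section SingleOutput

variable {𝒳 : Type*} (k : 𝒳 → 𝒳 → ℝ) (σ : ℝ)

/-- `K + σ² I` for a scalar kernel `k`. -/
noncomputable def scalarGram {t : ℕ} (a : Fin t → 𝒳) : Matrix (Fin t) (Fin t) ℝ :=
  Matrix.of (fun s s' => k (a s) (a s')) + σ ^ 2 • (1 : Matrix _ _ ℝ)

/-- The posterior variance at `x` for a scalar kernel `k`. -/
noncomputable def scalarVar {t : ℕ} (a : Fin t → 𝒳) (x : 𝒳) : ℝ :=
  k x x - (fun s => k (a s) x) ⬝ᵥ ((scalarGram k σ a)⁻¹ *ᵥ fun s => k (a s) x)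

variable {k σ}

lemma scalarVar_le {t : ℕ} {a : Fin t → 𝒳} (hA : (scalarGram k σ a).PosDef) (x : 𝒳) :
    scalarVar k σ a x ≤ k x x := by
  have := two_mul_dotProduct_sub_le hA (fun s => k (a s) x) 0
  simp only [zero_dotProduct] at this
  simp only [scalarVar]
  linarith

/-- Adding a point borders the Gram matrix by one row and column; the Schur complement of the old
block is the noise variance plus the posterior variance at the new point. -/
lemma det_scalarGram_succ (hk : ∀ x y, k x y = k y x) (a : ℕ → 𝒳) (t : ℕ)
    (hA : (scalarGram k σ fun s : Fin t => a s).PosDef) :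
    (scalarGram k σ fun s : Fin (t + 1) => a s).det
      = (scalarGram k σ fun s : Fin t => a s).det
        * (σ ^ 2 + scalarVar k σ (fun s : Fin t => a s) (a t)) := by
  have hdet := hA.det_pos.ne'.isUnit
  let _ := Matrix.invertibleOfIsUnitDet _ hdet
  have hblock : (scalarGram k σ fun s : Fin (t + 1) => a s).submatrix finSumFinEquiv finSumFinEquiv
      = Matrix.fromBlocks (scalarGram k σ fun s : Fin t => a s)
        (Matrix.of fun (s : Fin t) (_ : Fin 1) => k (a s) (a t))
        (Matrix.of fun (_ : Fin 1) (s : Fin t) => k (a s) (a t))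
        (Matrix.of fun _ _ => k (a t) (a t) + σ ^ 2) := by
    ext i j
    rcases i with i | i <;> rcases j with j | j
    · simp [scalarGram, Matrix.one_apply, Fin.ext_iff]
    · have : (i : ℕ) ≠ t := i.2.ne
      simp [scalarGram, Fin.ext_iff, this]
    · have : t ≠ (j : ℕ) := j.2.ne'
      simp [scalarGram, Fin.ext_iff, this, hk (a t)]
    · simp [scalarGram, Matrix.one_apply, Fin.ext_iff]
  rw [← Matrix.det_submatrix_equiv_self finSumFinEquiv, hblock, Matrix.det_fromBlocks₁₁]
  congr 1
  rw [Matrix.det_fin_one, Matrix.invOf_eq_nonsing_inv, Matrix.sub_apply, Matrix.mul_assoc,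
    Matrix.mul_apply_eq_vecMul]
  simp only [scalarVar, Matrix.of_apply, Matrix.mul_apply, dotProduct, mulVec, vecMul]
  ring

lemma det_scalarGram (hk : ∀ x y, k x y = k y x) (a : ℕ → 𝒳)
    (hA : ∀ t, (scalarGram k σ fun s : Fin t => a s).PosDef) (T : ℕ) :
    (scalarGram k σ fun s : Fin T => a s).det
      = ∏ t ∈ Finset.range T, (σ ^ 2 + scalarVar k σ (fun s : Fin t => a s) (a t)) := by
  induction T with
  | zero => simp
  | succ T ih => rw [det_scalarGram_succ hk a T (hA T), ih, Finset.prod_range_succ]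

lemma sum_log_scalarVar (hσ : 0 < σ) (hk : ∀ x y, k x y = k y x) (a : ℕ → 𝒳)
    (hA : ∀ t, (scalarGram k σ fun s : Fin t => a s).PosDef)
    (hv : ∀ t, 0 ≤ scalarVar k σ (fun s : Fin t => a s) (a t)) (T : ℕ) :
    ∑ t ∈ Finset.range T, Real.log (1 + scalarVar k σ (fun s : Fin t => a s) (a t) / σ ^ 2)
      = Real.log (1 + (σ ^ 2)⁻¹ • Matrix.of fun s s' : Fin T => k (a s) (a s')).det := by
  have h1 : (1 + (σ ^ 2)⁻¹ • Matrix.of fun s s' : Fin T => k (a s) (a s'))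
      = (σ ^ 2)⁻¹ • scalarGram k σ fun s : Fin T => a s := by
    rw [scalarGram, smul_add, smul_smul, inv_mul_cancel₀ (by positivity), one_smul, add_comm]
  rw [h1, Matrix.det_smul, det_scalarGram hk a hA, Fintype.card_fin]
  have h2 : ((σ ^ 2)⁻¹) ^ T = ∏ _t ∈ Finset.range T, (σ ^ 2)⁻¹ := by simp
  rw [h2, ← Finset.prod_mul_distrib, Real.log_prod]
  · refine Finset.sum_congr rfl fun t _ => ?_
    congr 1
    field_simp
  · intro t _
    have := hv t
    positivity

/-- From `log (1 + s) ≥ s / (1 + s)` at `s = v / σ²`. It turns the logarithms of the chain rule into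
variances. -/
lemma le_mul_log_one_add_div (hσ : 0 < σ) {v κ : ℝ} (hv : 0 ≤ v) (hvκ : v ≤ κ) :
    v ≤ (σ ^ 2 + κ) * Real.log (1 + v / σ ^ 2) := by
  have h1 : 1 - (1 + v / σ ^ 2)⁻¹ ≤ Real.log (1 + v / σ ^ 2) :=
    Real.one_sub_inv_le_log_of_pos (by positivity)
  have h2 : 1 - (1 + v / σ ^ 2)⁻¹ = v / (σ ^ 2 + v) := by
    field_simp
    ring
  rw [h2] at h1
  have h3 : v = (σ ^ 2 + v) * (v / (σ ^ 2 + v)) := by field_simp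
  have h4 : 0 ≤ σ ^ 2 + κ := add_nonneg (sq_nonneg σ) (hv.trans hvκ)
  calc v = (σ ^ 2 + v) * (v / (σ ^ 2 + v)) := h3
    _ ≤ (σ ^ 2 + κ) * Real.log (1 + v / σ ^ 2) := by gcongr

end SingleOutput

/-! ### Comparison of joint and single-output posteriors -/

section MultiOutput

variable {𝒳 : Type*} {m : ℕ} {K₀ : 𝒳 → 𝒳 → Matrix (Fin m) (Fin m) ℝ} {σ : ℝ} {t : ℕ}
  {a : Fin t → 𝒳}

lemma scalarGram_eq_submatrix (j : Fin m) :
    scalarGram (fun x y => K₀ x y j j) σ a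
      = (noisyGram K₀ σ a).submatrix (fun s => (s, j)) (fun s => (s, j)) := by
  ext s s'
  simp [scalarGram, noisyGram, Matrix.one_apply]

lemma posDef_scalarGram (hA : (noisyGram K₀ σ a).PosDef) (j : Fin m) :
    (scalarGram (fun x y => K₀ x y j j) σ a).PosDef := by
  rw [scalarGram_eq_submatrix]
  exact hA.submatrix fun s s' h => congrArg Prod.fst h

/-- Observing all outputs leaves less posterior variance in output `j` than observing only
output `j`. -/
lemma posteriorCov_le_scalarVar (hA : (noisyGram K₀ σ a).PosDef)
    (hK : ∀ x y j, K₀ x y j j = K₀ y x j j) (x : 𝒳) (j : Fin m) :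
    posteriorCov K₀ σ a x j j ≤ scalarVar (fun x y => K₀ x y j j) σ a x := by
  classical
  set A := noisyGram K₀ σ a
  set A₁ := scalarGram (fun x y => K₀ x y j j) σ a with hA₁
  set c : Fin t × Fin m → ℝ := crossCov K₀ a x j
  set k : Fin t → ℝ := fun s => K₀ (a s) x j j with hk
  set u : Fin t → ℝ := A₁⁻¹ *ᵥ k with hu
  -- The optimal weights for output `j` alone, extended by zero, are a suboptimal test vector for
  -- the joint problem.
  let w : Fin t × Fin m → ℝ := fun p => if p.2 = j then u p.1 else 0
  have hsum : ∀ f : Fin t × Fin m → ℝ, w ⬝ᵥ f = u ⬝ᵥ fun s => f (s, j) := by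
    intro f
    simp only [dotProduct, w, Fintype.sum_prod_type, ite_mul, zero_mul, Finset.sum_ite_eq',
      Finset.mem_univ, if_true]
  have h1 : w ⬝ᵥ c = u ⬝ᵥ k := by
    rw [hsum]
    congr 1
    funext s
    exact hK _ _ _
  have h2 : w ⬝ᵥ (A *ᵥ w) = u ⬝ᵥ (A₁ *ᵥ u) := by
    rw [hsum]
    congr 1
    funext s
    rw [Matrix.mulVec, dotProduct_comm, hsum, hA₁, scalarGram_eq_submatrix, Matrix.mulVec,
      dotProduct_comm]
    rfl
  have h3 : A₁ *ᵥ u = k := by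
    rw [hu, Matrix.mulVec_mulVec,
      Matrix.mul_nonsing_inv _ (posDef_scalarGram hA j).det_pos.ne'.isUnit, Matrix.one_mulVec]
  have h4 : posteriorCov K₀ σ a x j j = K₀ x x j j - c ⬝ᵥ (A⁻¹ *ᵥ c) := by
    rw [posteriorCov, Matrix.sub_apply, Matrix.mul_assoc, Matrix.mul_apply]
    rfl
  have h5 := two_mul_dotProduct_sub_le hA c w
  rw [h1, h2, h3] at h5
  rw [h4, scalarVar, ← hA₁, ← hk, ← hu, dotProduct_comm k u]
  linarith

end MultiOutput

/-- The posterior variances along any sequence of queries sum to a multiple of the information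
gain. -/
lemma IsGPModel.sum_posteriorCov_le {Ω 𝒳 : Type*} [MeasurableSpace Ω] [Fintype 𝒳] {P : Measure Ω}
    [IsProbabilityMeasure P] {m : ℕ} {μ₀ : 𝒳 → EuclideanSpace ℝ (Fin m)}
    {K₀ : 𝒳 → 𝒳 → Matrix (Fin m) (Fin m) ℝ} {σ κ : ℝ}
    {h : Ω → 𝒳 → EuclideanSpace ℝ (Fin m)} {ξ : ℕ → Ω → EuclideanSpace ℝ (Fin m)}
    (hM : IsGPModel P μ₀ K₀ σ h ξ) (hσ : 0 < σ) (hκ : ∀ x j, K₀ x x j j ≤ κ) (a : ℕ → 𝒳)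
    (j : Fin m) (T : ℕ) :
    ∑ t ∈ Finset.range T, posteriorCov K₀ σ (fun s : Fin t => a s) (a t) j j
      ≤ 2 * (σ ^ 2 + |κ|) * infoGainMax K₀ σ T := by
  have hK : ∀ x y j, K₀ x y j j = K₀ y x j j := fun x y j => by
    rw [← hM.cov_h, ← hM.cov_h, covariance_comm]
  have hA := fun t : ℕ => hM.posDef_noisyGram (fun s : Fin t => a s) hσ
  have hle := fun t => posteriorCov_le_scalarVar (hA t) hK (a t) j
  have hv : ∀ t, 0 ≤ scalarVar (fun x y => K₀ x y j j) σ (fun s : Fin t => a s) (a t) := fun t =>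
    ((hM.posSemidef_posteriorCov _ hσ (a t)).diag_nonneg).trans (hle t)
  have hgain : 1 / 2 * Real.log (1 + (σ ^ 2)⁻¹ • Matrix.of fun s s' : Fin T =>
      K₀ (a s) (a s') j j).det ≤ infoGainMax K₀ σ T :=
    (le_ciSup (f := fun b : Fin T → 𝒳 => 1 / 2 * Real.log
      (1 + (σ ^ 2)⁻¹ • Matrix.of fun s s' : Fin T => K₀ (b s) (b s') j j).det)
      (Set.finite_range _).bddAbove fun s => a s).trans
      (le_ciSup (f := fun j => infoGain K₀ σ j T) (Set.finite_range _).bddAbove j)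
  calc ∑ t ∈ Finset.range T, posteriorCov K₀ σ (fun s : Fin t => a s) (a t) j j
      ≤ ∑ t ∈ Finset.range T, (σ ^ 2 + |κ|) * Real.log
          (1 + scalarVar (fun x y => K₀ x y j j) σ (fun s : Fin t => a s) (a t) / σ ^ 2) :=
        Finset.sum_le_sum fun t _ => (hle t).trans (le_mul_log_one_add_div hσ (hv t)
          ((scalarVar_le (posDef_scalarGram (hA t) j) _).trans
            ((hκ _ _).trans (le_abs_self κ))))
    _ = (σ ^ 2 + |κ|) * Real.log (1 + (σ ^ 2)⁻¹ • Matrix.of fun s s' : Fin T =>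
          K₀ (a s) (a s') j j).det := by
        rw [← Finset.mul_sum, sum_log_scalarVar (k := fun x y => K₀ x y j j) hσ
          (fun x y => hK x y j) a (fun t => posDef_scalarGram (hA t) j) hv]
    _ ≤ 2 * (σ ^ 2 + |κ|) * infoGainMax K₀ σ T := by
        -- The factor `2` in the bound undoes the `1/2` in the information gain.
        have : 0 ≤ σ ^ 2 + |κ| := by positivity
        nlinarith

/-! ### Quantile bounds -/

/-- The point is that the set under the infimum is bounded below, because the distribution function
tends to `0 < p` at `-∞`; otherwise `sInf` would be a default value. -/
lemma quantile_le {ν : Measure ℝ} [IsProbabilityMeasure ν] {p y : ℝ} (hp : 0 < p)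
    (hy : p ≤ ν.real (Set.Iic y)) : quantile ν p ≤ y := by
  refine csInf_le ?_ hy
  have hlim : Tendsto (fun y => ν.real (Set.Iic y)) atBot (𝓝 0) := by
    simpa only [← cdf_eq_real] using tendsto_cdf_atBot ν
  obtain ⟨b, hb⟩ := eventually_atBot.1 (hlim.eventually_lt_const hp)
  refine ⟨b, fun z hz => ?_⟩
  by_contra! hlt
  exact absurd (show p ≤ ν.real (Set.Iic z) from hz) (not_le.2 (hb z hlt.le))

lemma measure_exists_abs_gt_le {m : ℕ} (μ : EuclideanSpace ℝ (Fin m))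
    {S : Matrix (Fin m) (Fin m) ℝ} (hS : S.PosSemidef) {β : ℝ} (hβ : 0 ≤ β) :
    (multivariateGaussian μ S).real {y | ∃ j, β * √(S j j) < |y j - μ j|}
      ≤ m * (2 * Real.exp (-β ^ 2 / 2)) := by
  have hj : ∀ j, (multivariateGaussian μ S).real {y | β * √(S j j) < |y j - μ j|}
      ≤ 2 * Real.exp (-β ^ 2 / 2) := by
    intro j
    refine ENNReal.toReal_le_of_le_ofReal (by positivity)
      (measure_abs_gt_le (by fun_prop) hS.diag_nonneg ?_ hβ)
    have h1 := (measurePreserving_eval_multivariateGaussian (μ := μ) hS (i := j)).map_eq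
    have h2 := gaussianReal_map_sub_const (μ := μ j) (v := (S j j).toNNReal) (μ j)
    rw [← h1, Measure.map_map (by fun_prop) (by fun_prop), sub_self] at h2
    exact h2
  have hU : {y : EuclideanSpace ℝ (Fin m) | ∃ j, β * √(S j j) < |y j - μ j|}
      = ⋃ j, {y | β * √(S j j) < |y j - μ j|} := by
    ext y
    simp
  rw [hU]
  calc _ ≤ ∑ j, (multivariateGaussian μ S).real {y | β * √(S j j) < |y j - μ j|} :=
        measureReal_iUnion_fintype_le _
    _ ≤ ∑ _j : Fin m, 2 * Real.exp (-β ^ 2 / 2) := Finset.sum_le_sum fun j _ => hj j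
    _ = m * (2 * Real.exp (-β ^ 2 / 2)) := by simp

lemma measurable_of_abs_sub_le_sum {m : ℕ} {f : EuclideanSpace ℝ (Fin m) → ℝ} {L : ℝ≥0}
    (hf : ∀ y z, |f y - f z| ≤ L * ∑ j, |y j - z j|) : Measurable f := by
  refine Continuous.measurable (continuous_iff_continuousAt.2 fun z => ?_)
  have h : Tendsto (fun y : EuclideanSpace ℝ (Fin m) => (L : ℝ) * ∑ j, |y j - z j|) (𝓝 z) (𝓝 0) := by
    have hc : Continuous fun y : EuclideanSpace ℝ (Fin m) => (L : ℝ) * ∑ j, |y j - z j| := by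
      fun_prop
    simpa using hc.tendsto z
  exact tendsto_iff_norm_sub_tendsto_zero.2
    (squeeze_zero (fun y => norm_nonneg _) (fun y => hf y z) h)

/-- Off an event of mass at most `1 - p`, all coordinates lie within `β` standard deviations of `μ`,
and there the Lipschitz condition bounds `f`. -/
lemma quantile_map_multivariateGaussian_le {m : ℕ} {f : EuclideanSpace ℝ (Fin m) → ℝ} {L : ℝ≥0}
    (hf : ∀ y z, |f y - f z| ≤ L * ∑ j, |y j - z j|) (μ : EuclideanSpace ℝ (Fin m))
    {S : Matrix (Fin m) (Fin m) ℝ} (hS : S.PosSemidef) {β p : ℝ} (hβ : 0 ≤ β) (hp : 0 < p)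
    (hpβ : m * (2 * Real.exp (-β ^ 2 / 2)) ≤ 1 - p) :
    quantile ((multivariateGaussian μ S).map f) p ≤ f μ + L * ∑ j, β * √(S j j) := by
  have hfm := measurable_of_abs_sub_le_sum hf
  have := Measure.isProbabilityMeasure_map (μ := multivariateGaussian μ S) hfm.aemeasurable
  refine quantile_le hp ?_
  rw [map_measureReal_apply hfm measurableSet_Iic]
  have hms : MeasurableSet {y : EuclideanSpace ℝ (Fin m) | ∃ j, β * √(S j j) < |y j - μ j|} := by
    simp only [Set.ofPred_exists]
    exact MeasurableSet.iUnion fun j => measurableSet_lt (by fun_prop) (by fun_prop)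
  have hsub : {y : EuclideanSpace ℝ (Fin m) | ∃ j, β * √(S j j) < |y j - μ j|}ᶜ
      ⊆ f ⁻¹' Set.Iic (f μ + L * ∑ j, β * √(S j j)) := by
    intro y hy
    have hy' : ∀ j, |y j - μ j| ≤ β * √(S j j) := by simpa using hy
    have h1 : (L : ℝ) * ∑ j, |y j - μ j| ≤ L * ∑ j, β * √(S j j) := by
      gcongr with j
      exact hy' j
    have h2 := (le_abs_self _).trans (hf y μ)
    simp only [Set.mem_preimage, Set.mem_Iic]
    linarith
  have h1 := measureReal_mono (μ := multivariateGaussian μ S) hsub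
  rw [probReal_compl_eq_one_sub hms] at h1
  have h2 := measure_exists_abs_gt_le μ hS hβ
  linarith

/-! ### Confidence widths -/

/-- The constant `B` for which `B (t + 1)² = 4 (m + 1) / α_t`. -/
noncomputable def widthConst (m n N : ℕ) (δ : ℝ) : ℝ :=
  4 * ((m : ℝ) + 1) * (Real.pi ^ 2 * ((n : ℝ) + 1) * N) / (6 * δ)

/-- The number of posterior standard deviations used at iteration `t`. -/
noncomputable def width (m n N : ℕ) (δ : ℝ) (t : ℕ) : ℝ :=
  √(2 * Real.log (widthConst m n N δ * ((t : ℝ) + 1) ^ 2))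

section Width

variable {m n N : ℕ} {δ : ℝ}

lemma one_le_widthConst (hδ₀ : 0 < δ) (hδ₁ : δ < 1) (hN : 1 ≤ N) : 1 ≤ widthConst m n N δ := by
  rw [widthConst, le_div_iff₀ (by positivity)]
  have hpi : 9 ≤ Real.pi ^ 2 := by nlinarith [Real.pi_gt_three]
  have hN' : (1 : ℝ) ≤ N := by exact_mod_cast hN
  have h1 : (1 : ℝ) ≤ (n : ℝ) + 1 := by simp
  have h2 : (1 : ℝ) ≤ (m : ℝ) + 1 := by simp
  have h3 : 9 * 1 * 1 ≤ Real.pi ^ 2 * ((n : ℝ) + 1) * N := by gcongr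
  have h4 : 4 * 1 * (9 * 1 * 1) ≤ 4 * ((m : ℝ) + 1) * (Real.pi ^ 2 * ((n : ℝ) + 1) * N) := by
    gcongr
  linarith

lemma width_nonneg (t : ℕ) : 0 ≤ width m n N δ t := Real.sqrt_nonneg _

lemma one_le_widthConst_mul_sq (hδ₀ : 0 < δ) (hδ₁ : δ < 1) (hN : 1 ≤ N) (t : ℕ) :
    1 ≤ widthConst m n N δ * ((t : ℝ) + 1) ^ 2 :=
  one_le_mul_of_one_le_of_one_le (one_le_widthConst hδ₀ hδ₁ hN) (one_le_pow₀ (by simp))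

lemma exp_neg_width_sq (hδ₀ : 0 < δ) (hδ₁ : δ < 1) (hN : 1 ≤ N) (t : ℕ) :
    Real.exp (-width m n N δ t ^ 2 / 2) = level δ n N t / (4 * ((m : ℝ) + 1)) := by
  have h1 := one_le_widthConst_mul_sq (m := m) (n := n) hδ₀ hδ₁ hN t
  have hN' : (0 : ℝ) < N := by exact_mod_cast hN
  rw [width, Real.sq_sqrt (mul_nonneg (by norm_num) (Real.log_nonneg h1)), neg_div,
    mul_div_cancel_left₀ _ (by norm_num), Real.exp_neg, Real.exp_log (by linarith)]
  rw [widthConst, level]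
  field_simp

/-- One estimate with two uses: the mass above the quantile and the failure probability of the
confidence bounds. Taking `m + 1` in `widthConst` avoids division by zero for `m = 0`. -/
lemma tail_le_level (hδ₀ : 0 < δ) (hδ₁ : δ < 1) (hN : 1 ≤ N) (t : ℕ) :
    m * (2 * Real.exp (-width m n N δ t ^ 2 / 2)) ≤ level δ n N t / 2 := by
  rw [exp_neg_width_sq hδ₀ hδ₁ hN]
  have hl : 0 ≤ level δ n N t := by unfold level; positivity
  have h1 : (m : ℝ) * (2 * (level δ n N t / (4 * ((m : ℝ) + 1))))
      = level δ n N t / 2 * (m / ((m : ℝ) + 1)) := by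
    field_simp
    ring
  rw [h1]
  exact mul_le_of_le_one_right (by positivity) ((div_le_one (by positivity)).2 (by linarith))

lemma card_mul_level (hN : 1 ≤ N) (t : ℕ) :
    N * level δ n N t = 6 * δ / (Real.pi ^ 2 * ((n : ℝ) + 1)) * (1 / ((t : ℝ) + 1) ^ 2) := by
  have hN' : (0 : ℝ) < N := by exact_mod_cast hN
  rw [level]
  field_simp

lemma level_lt_one (hδ₀ : 0 < δ) (hδ₁ : δ < 1) (hN : 1 ≤ N) (t : ℕ) : level δ n N t < 1 := by
  have hpi : 9 ≤ Real.pi ^ 2 := by nlinarith [Real.pi_gt_three]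
  have hN' : (1 : ℝ) ≤ N := by exact_mod_cast hN
  have h1 : (1 : ℝ) ≤ (n : ℝ) + 1 := by simp
  have h2 : (1 : ℝ) ≤ ((t : ℝ) + 1) ^ 2 := one_le_pow₀ (by simp)
  have h3 : 9 * 1 * 1 * 1 ≤ Real.pi ^ 2 * ((t : ℝ) + 1) ^ 2 * ((n : ℝ) + 1) * N := by gcongr
  rw [level, div_lt_one (by positivity)]
  linarith

lemma hasSum_card_mul_level (hN : 1 ≤ N) :
    HasSum (fun t : ℕ => N * level δ n N t) (δ / ((n : ℝ) + 1)) := by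
  -- Basel sum shifted by one; the dropped term `1 / 0 ^ 2` is `0` by convention.
  have h := (hasSum_nat_add_iff' 1).2 hasSum_zeta_two
  have h2 := h.mul_left (6 * δ / (Real.pi ^ 2 * ((n : ℝ) + 1)))
  have h3 : (fun t : ℕ => N * level δ n N t)
      = fun t => 6 * δ / (Real.pi ^ 2 * ((n : ℝ) + 1)) * (1 / ((t + 1 : ℕ) : ℝ) ^ 2) := by
    funext t
    rw [card_mul_level hN]
    push_cast
    ring
  have h4 : δ / ((n : ℝ) + 1) = 6 * δ / (Real.pi ^ 2 * ((n : ℝ) + 1)) *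
      (Real.pi ^ 2 / 6 - ∑ i ∈ Finset.range 1, 1 / (i : ℝ) ^ 2) := by
    simp only [Finset.range_one, Finset.sum_singleton, Nat.cast_zero, ne_eq, OfNat.ofNat_ne_zero,
      not_false_eq_true, zero_pow, div_zero, sub_zero]
    field_simp
  rw [h3, h4]
  exact h2

/-- Since `T ≥ 2`, the constant `log B` is absorbed into `(log B / log 2) log T`. -/
lemma width_le_sqrt_log (hδ₀ : 0 < δ) (hδ₁ : δ < 1) (hN : 1 ≤ N) {t T : ℕ} (htT : t < T)
    (hT : 2 ≤ T) :
    width m n N δ t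
      ≤ √(2 * Real.log (widthConst m n N δ) / Real.log 2 + 4) * √(Real.log T) := by
  have hB := one_le_widthConst (m := m) (n := n) hδ₀ hδ₁ hN
  have hlog2 : 0 < Real.log 2 := Real.log_pos (by norm_num)
  have hT' : (2 : ℝ) ≤ T := by exact_mod_cast hT
  have hlogT : Real.log 2 ≤ Real.log T := Real.log_le_log (by norm_num) hT'
  have htT' : (t : ℝ) + 1 ≤ T := by exact_mod_cast htT
  have hlogt : Real.log ((t : ℝ) + 1) ≤ Real.log T := Real.log_le_log (by positivity) htT'
  have hlogB := Real.log_nonneg hB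
  rw [← Real.sqrt_mul (by positivity), width]
  refine Real.sqrt_le_sqrt ?_
  rw [Real.log_mul (by linarith) (by positivity), Real.log_pow, add_mul]
  have h1 : 2 * Real.log (widthConst m n N δ)
      ≤ 2 * Real.log (widthConst m n N δ) / Real.log 2 * Real.log T := by
    rw [div_mul_eq_mul_div, le_div_iff₀ hlog2]
    gcongr
  push_cast
  linarith

end Width

/-! ### Detection of infeasibility -/

section Run

variable {Ω 𝒳 : Type*} [MeasurableSpace Ω] [Fintype 𝒳] [MeasurableSpace 𝒳]
  [MeasurableSingletonClass 𝒳] {P : Measure Ω} [IsProbabilityMeasure P]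
  {m n : ℕ} {μ₀ : 𝒳 → EuclideanSpace ℝ (Fin m)}
  {K₀ : 𝒳 → 𝒳 → Matrix (Fin m) (Fin m) ℝ} {σ κ δ : ℝ}
  {g : Fin (n + 1) → 𝒳 → EuclideanSpace ℝ (Fin m) → ℝ} {L : Fin (n + 1) → ℝ≥0}
  {h : Ω → 𝒳 → EuclideanSpace ℝ (Fin m)} {ξ : ℕ → Ω → EuclideanSpace ℝ (Fin m)}
  {x : ℕ → Ω → 𝒳}

/-- The event that the posterior mean is, at iteration `t`, point `z` and output `j`, off by more
than the confidence width. -/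
def missEvent (μ₀ : 𝒳 → EuclideanSpace ℝ (Fin m)) (K₀ : 𝒳 → 𝒳 → Matrix (Fin m) (Fin m) ℝ)
    (σ δ : ℝ) (n : ℕ) (h : Ω → 𝒳 → EuclideanSpace ℝ (Fin m))
    (ξ : ℕ → Ω → EuclideanSpace ℝ (Fin m)) (x : ℕ → Ω → 𝒳) (t : ℕ) (z : 𝒳) (j : Fin m) : Set Ω :=
  {ω | width m n (Fintype.card 𝒳) δ t * √(posteriorCov K₀ σ (fun s : Fin t => x s ω) z j j) <
    |h ω z j - posteriorMean μ₀ K₀ σ (fun s : Fin t => x s ω)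
      (fun s : Fin t => obs h ξ x s ω) z j|}

/-- Union bound over times, points and outputs. The events concern `h` itself, so one family serves
all constraints at once, and the total is even at most `δ / (n + 1)`. -/
lemma measure_iUnion_missEvent_le [Nonempty 𝒳] (hM : IsGPModel P μ₀ K₀ σ h ξ) (hσ : 0 < σ)
    (hδ₀ : 0 < δ) (hδ₁ : δ < 1)
    (hx : ∀ t, Measurable[⨆ s : Fin t, MeasurableSpace.comap (obs h ξ x s) inferInstance] (x t)) :
    P (⋃ t, ⋃ z, ⋃ j, missEvent μ₀ K₀ σ δ n h ξ x t z j) ≤ ENNReal.ofReal δ := by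
  set N := Fintype.card 𝒳 with hN'
  have hN : 1 ≤ N := Fintype.card_pos
  have hl : ∀ t, 0 ≤ N * level δ n N t := fun t => by unfold level; positivity
  have ht : ∀ t, P (⋃ z, ⋃ j, missEvent μ₀ K₀ σ δ n h ξ x t z j)
      ≤ ENNReal.ofReal (N * level δ n N t) := by
    intro t
    calc P (⋃ z, ⋃ j, missEvent μ₀ K₀ σ δ n h ξ x t z j)
        ≤ ∑ _z : 𝒳, ∑ _j : Fin m, ENNReal.ofReal (2 * Real.exp (-width m n N δ t ^ 2 / 2)) := by
          refine (measure_iUnion_fintype_le _ _).trans (Finset.sum_le_sum fun z _ => ?_)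
          refine (measure_iUnion_fintype_le _ _).trans (Finset.sum_le_sum fun j _ => ?_)
          exact measure_abs_sub_posteriorMean_gt_le hM hσ hx t z j (width_nonneg t)
      _ = ENNReal.ofReal (N * (m * (2 * Real.exp (-width m n N δ t ^ 2 / 2)))) := by
          rw [ENNReal.ofReal_mul (by positivity), ENNReal.ofReal_mul (by positivity)]
          simp [hN']
      _ ≤ ENNReal.ofReal (N * level δ n N t) := by
          refine ENNReal.ofReal_le_ofReal (mul_le_mul_of_nonneg_left ?_ (by positivity))
          have h0 : 0 ≤ level δ n N t := by unfold level; positivity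
          linarith [tail_le_level (m := m) (n := n) hδ₀ hδ₁ hN t]
  have hs := hasSum_card_mul_level (n := n) (N := N) (δ := δ) hN
  calc P (⋃ t, ⋃ z, ⋃ j, missEvent μ₀ K₀ σ δ n h ξ x t z j)
      ≤ ∑' t, ENNReal.ofReal (N * level δ n N t) :=
        (measure_iUnion_le _).trans (ENNReal.tsum_le_tsum ht)
    _ = ENNReal.ofReal (δ / ((n : ℝ) + 1)) := by
        rw [← ENNReal.ofReal_tsum_of_nonneg hl hs.summable, hs.tsum_eq]
    _ ≤ ENNReal.ofReal δ :=
        ENNReal.ofReal_le_ofReal (div_le_self hδ₀.le (by simp))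

omit [MeasurableSpace 𝒳] [MeasurableSingletonClass 𝒳] in
/-- Off the miss events an upper bound exceeds the true value by at most two confidence
widths. -/
lemma runUpper_sub_le [Nonempty 𝒳] (hM : IsGPModel P μ₀ K₀ σ h ξ) (hσ : 0 < σ)
    (hδ₀ : 0 < δ) (hδ₁ : δ < 1) (hg : ∀ i p y z, |g i p y - g i p z| ≤ L i * ∑ j, |y j - z j|)
    {ω : Ω} (t : ℕ) (z : 𝒳) (hω : ∀ j, ω ∉ missEvent μ₀ K₀ σ δ n h ξ x t z j)
    (i : Fin (n + 1)) :
    runUpper μ₀ K₀ σ g δ h ξ x t ω i z - g i z (h ω z)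
      ≤ 2 * L i * width m n (Fintype.card 𝒳) δ t *
        ∑ j, √(posteriorCov K₀ σ (fun s : Fin t => x s ω) z j j) := by
  have hN : 1 ≤ Fintype.card 𝒳 := Fintype.card_pos
  have hS := hM.posSemidef_posteriorCov (fun s : Fin t => x s ω) hσ z
  have hl1 := level_lt_one (n := n) hδ₀ hδ₁ hN t
  -- One width comes from the quantile bound, the other from the distance between `h` and the
  -- posterior mean.
  have h1 : runUpper μ₀ K₀ σ g δ h ξ x t ω i z ≤ _ :=
    quantile_map_multivariateGaussian_le (hg i z)
      (posteriorMean μ₀ K₀ σ (fun s : Fin t => x s ω) (fun s : Fin t => obs h ξ x s ω) z) hS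
      (width_nonneg (m := m) (n := n) (N := Fintype.card 𝒳) (δ := δ) t)
      (p := 1 - level δ n (Fintype.card 𝒳) t / 2) (by linarith)
      (by linarith [tail_le_level (m := m) (n := n) hδ₀ hδ₁ hN t])
  have h2 := (neg_abs_le _).trans' (neg_le_neg (hg i z (h ω z)
    (posteriorMean μ₀ K₀ σ (fun s : Fin t => x s ω) (fun s : Fin t => obs h ξ x s ω) z)))
  have h3 : (L i : ℝ) * ∑ j, |h ω z j - posteriorMean μ₀ K₀ σ (fun s : Fin t => x s ω)
      (fun s : Fin t => obs h ξ x s ω) z j| ≤ L i * ∑ j, width m n (Fintype.card 𝒳) δ t *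
        √(posteriorCov K₀ σ (fun s : Fin t => x s ω) z j j) := by
    gcongr with j
    exact not_lt.1 (hω j)
  rw [← Finset.mul_sum] at h1 h3
  linarith

omit [MeasurableSpace 𝒳] [MeasurableSingletonClass 𝒳] in
/-- The sum over time of the posterior standard deviations at the queried points. -/
lemma sum_sqrt_posteriorCov_le (hM : IsGPModel P μ₀ K₀ σ h ξ) (hσ : 0 < σ)
    (hκ : ∀ x j, K₀ x x j j ≤ κ) (a : ℕ → 𝒳) (T : ℕ) :
    ∑ t ∈ Finset.range T, ∑ j, √(posteriorCov K₀ σ (fun s : Fin t => a s) (a t) j j)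
      ≤ m * √(T * (2 * (σ ^ 2 + |κ|) * infoGainMax K₀ σ T)) := by
  rw [Finset.sum_comm]
  have hj : ∀ j : Fin m,
      ∑ t ∈ Finset.range T, √(posteriorCov K₀ σ (fun s : Fin t => a s) (a t) j j)
        ≤ √(T * (2 * (σ ^ 2 + |κ|) * infoGainMax K₀ σ T)) := by
    intro j
    -- Cauchy–Schwarz in time.
    refine Real.le_sqrt_of_sq_le ((sq_sum_le_card_mul_sum_sq).trans ?_)
    rw [Finset.card_range]
    refine mul_le_mul_of_nonneg_left (le_of_eq_of_le ?_ (hM.sum_posteriorCov_le hσ hκ a j T))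
      (by positivity)
    exact Finset.sum_congr rfl fun t _ =>
      Real.sq_sqrt (hM.posSemidef_posteriorCov _ hσ (a t)).diag_nonneg
  calc _ ≤ ∑ _j : Fin m, √(T * (2 * (σ ^ 2 + |κ|) * infoGainMax K₀ σ T)) :=
        Finset.sum_le_sum fun j _ => hj j
    _ = m * √(T * (2 * (σ ^ 2 + |κ|) * infoGainMax K₀ σ T)) := by simp

/-- The constant in the bound for the constraint violation while infeasibility is undetected. -/
noncomputable def rateConst (m n N : ℕ) (δ σ κ : ℝ) (L : Fin (n + 1) → ℝ≥0) : ℝ :=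
  2 * (∑ i, (L i : ℝ)) * √(2 * Real.log (widthConst m n N δ) / Real.log 2 + 4) *
    (m * √(2 * (σ ^ 2 + |κ|)))

lemma rateConst_nonneg (m n N : ℕ) (δ σ κ : ℝ) (L : Fin (n + 1) → ℝ≥0) :
    0 ≤ rateConst m n N δ σ κ L := by
  unfold rateConst
  positivity

omit [MeasurableSpace 𝒳] [MeasurableSingletonClass 𝒳] in
/-- If infeasibility stays undetected for `T` iterations, then the constraints are violated by at
most a multiple of `√(log T * γ_T / T)`. -/
lemma violation_le_of_undeclared [Nonempty 𝒳] (hM : IsGPModel P μ₀ K₀ σ h ξ) (hσ : 0 < σ)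
    (hδ₀ : 0 < δ) (hδ₁ : δ < 1) (hg : ∀ i p y z, |g i p y - g i p z| ≤ L i * ∑ j, |y j - z j|)
    (hκ : ∀ x j, K₀ x x j j ≤ κ) {ω : Ω}
    (hω : ∀ t z j, ω ∉ missEvent μ₀ K₀ σ δ n h ξ x t z j) {T : ℕ} (hT : 2 ≤ T)
    (hfeas : ∀ t < T, ∀ i : Fin n, 0 ≤ runUpper μ₀ K₀ σ g δ h ξ x t ω i.succ (x t ω))
    (i : Fin n) :
    -(⨆ p, g i.succ p (h ω p))
      ≤ rateConst m n (Fintype.card 𝒳) δ σ κ L * √(Real.log T * infoGainMax K₀ σ T / T) := by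
  have hN : 1 ≤ Fintype.card 𝒳 := Fintype.card_pos
  set N := Fintype.card 𝒳
  set ε := -(⨆ p, g i.succ p (h ω p))
  set D := √(2 * Real.log (widthConst m n N δ) / Real.log 2 + 4)
  set V : ℕ → ℝ := fun t =>
    ∑ j, √(posteriorCov K₀ σ (fun s : Fin t => x s ω) (x t ω) j j) with hV
  have hVnn : ∀ t, 0 ≤ V t := fun t => Finset.sum_nonneg fun j _ => Real.sqrt_nonneg _
  have hLi : (L i.succ : ℝ) ≤ ∑ i, (L i : ℝ) :=
    Finset.single_le_sum (f := fun i => (L i : ℝ)) (fun i _ => (L i).2) (Finset.mem_univ _)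
  -- Here `0 ≤ u_i` and `f_i ≤ -ε` at the query. Replacing `L i` by the sum of all Lipschitz
  -- constants makes the bound uniform in `i`.
  have hstep : ∀ t ∈ Finset.range T,
      ε ≤ 2 * (∑ i, (L i : ℝ)) * (D * √(Real.log T)) * V t := by
    intro t ht
    have htT := Finset.mem_range.1 ht
    have h1 := runUpper_sub_le hM hσ hδ₀ hδ₁ hg t (x t ω) (hω t (x t ω)) i.succ
    have h2 := hfeas t htT i
    have h3 : g i.succ (x t ω) (h ω (x t ω)) ≤ ⨆ p, g i.succ p (h ω p) :=
      le_ciSup (f := fun p => g i.succ p (h ω p)) (Set.finite_range _).bddAbove _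
    have h4 : 2 * L i.succ * width m n N δ t * V t
        ≤ 2 * (∑ i, (L i : ℝ)) * (D * √(Real.log T)) * V t := by
      have h5 := width_le_sqrt_log (m := m) (n := n) hδ₀ hδ₁ hN htT hT
      have h6 := width_nonneg (m := m) (n := n) (N := N) (δ := δ) t
      have h7 := hVnn t
      gcongr
    simp only [ε]
    linarith
  have hsum := Finset.sum_le_sum hstep
  rw [Finset.sum_const, Finset.card_range, nsmul_eq_mul, ← Finset.mul_sum] at hsum
  have hVs : ∑ t ∈ Finset.range T, V t ≤ _ := sum_sqrt_posteriorCov_le hM hσ hκ (fun t => x t ω) T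
  have hTpos : (0 : ℝ) < T := by exact_mod_cast (by omega : 0 < T)
  have hlog : 0 ≤ Real.log T := Real.log_natCast_nonneg T
  have hroot : √(Real.log T) * √(T * (2 * (σ ^ 2 + |κ|) * infoGainMax K₀ σ T))
      = T * (√(2 * (σ ^ 2 + |κ|)) * √(Real.log T * infoGainMax K₀ σ T / T)) := by
    rw [← Real.sqrt_mul hlog, ← Real.sqrt_mul (by positivity)]
    -- Writing `T = √(T²)` brings both sides under one root.
    nth_rw 3 [← Real.sqrt_sq hTpos.le]
    rw [← Real.sqrt_mul (by positivity)]
    congr 1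
    field_simp
  refine le_of_mul_le_mul_left (hsum.trans ?_) hTpos
  calc 2 * (∑ i, (L i : ℝ)) * (D * √(Real.log T)) * ∑ t ∈ Finset.range T, V t
      ≤ 2 * (∑ i, (L i : ℝ)) * (D * √(Real.log T)) *
        (m * √(T * (2 * (σ ^ 2 + |κ|) * infoGainMax K₀ σ T))) := by gcongr
    _ = 2 * (∑ i, (L i : ℝ)) * D * m *
        (√(Real.log T) * √(T * (2 * (σ ^ 2 + |κ|) * infoGainMax K₀ σ T))) := by ring
    _ = T * (rateConst m n N δ σ κ L * √(Real.log T * infoGainMax K₀ σ T / T)) := by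
        rw [hroot, rateConst]
        ring

end Run

end CUQB

/-! ### The main theorem -/

theorem mainTheorem4 (m n N : ℕ) (δ σ κ : ℝ) (L : Fin (n + 1) → ℝ≥0)
    (hδ₀ : 0 < δ) (hδ₁ : δ < 1) (hσ : 0 < σ) :
    ∃ C : ℝ, 0 < C ∧
      ∀ (d : ℕ) (X : Finset (EuclideanSpace ℝ (Fin d))), X.Nonempty → X.card = N →
      ∀ (μ₀ : X → EuclideanSpace ℝ (Fin m)) (K₀ : X → X → Matrix (Fin m) (Fin m) ℝ),
        (∀ p j, K₀ p p j j ≤ κ) →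
      ∀ g : Fin (n + 1) → X → EuclideanSpace ℝ (Fin m) → ℝ,
        (∀ i p y z, |g i p y - g i p z| ≤ L i * ∑ j, |y j - z j|) →
      Tendsto (fun T : ℕ => Real.log T * CUQB.infoGainMax K₀ σ T / T) atTop (𝓝 0) →
      ∀ (Ω : Type*) [MeasurableSpace Ω] (P : Measure Ω) [IsProbabilityMeasure P]
        (h : Ω → X → EuclideanSpace ℝ (Fin m)) (ξ : ℕ → Ω → EuclideanSpace ℝ (Fin m))
        (x : ℕ → Ω → X),
        CUQB.IsGPModel P μ₀ K₀ σ h ξ →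
        CUQB.IsRun μ₀ K₀ σ g δ h ξ x →
        ∃ A : Set Ω, MeasurableSet A ∧ ENNReal.ofReal (1 - δ) ≤ P A ∧
          ∀ ω ∈ A, ∀ (i : Fin n) (ε : ℝ), ε = -(⨆ p, g i.succ p (h ω p)) → 0 < ε →
            ∃ Tbar : ℕ,
              IsLeast {T : ℕ | 2 ≤ T ∧
                √(Real.log T * CUQB.infoGainMax K₀ σ T / T) < C * ε} Tbar ∧
              ((∀ t < Tbar, CUQB.Undeclared (CUQB.runUpper μ₀ K₀ σ g δ h ξ x) t ω →
                  (CUQB.auxSolutions (CUQB.runUpper μ₀ K₀ σ g δ h ξ x t ω)).Nonempty) →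
                ∃ t < Tbar,
                  CUQB.DeclaresInfeasible (CUQB.runUpper μ₀ K₀ σ g δ h ξ x t ω)) := by
  have hR := CUQB.rateConst_nonneg m n N δ σ κ L
  -- With `R = rateConst`, `C R = R / (1 + R) < 1`; the added `1` also keeps `C` finite when `R =
  -- 0`.
  refine ⟨1 / (1 + CUQB.rateConst m n N δ σ κ L), by positivity, ?_⟩
  intro d X hX hN μ₀ K₀ hκ g hg hlim Ω _ P _ h ξ x hM hrun
  have : Nonempty X := hX.to_subtype
  have hcard : Fintype.card X = N := by simpa using hN
  set B := ⋃ t, ⋃ z, ⋃ j, CUQB.missEvent μ₀ K₀ σ δ n h ξ x t z j with hB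
  -- A measurable hull has the same probability, so measurability of the bad event need not be
  -- checked.
  refine ⟨(toMeasurable P B)ᶜ, (measurableSet_toMeasurable P B).compl, ?_, ?_⟩
  · rw [prob_compl_eq_one_sub (measurableSet_toMeasurable P B), measure_toMeasurable,
      ENNReal.ofReal_sub _ hδ₀.le, ENNReal.ofReal_one]
    exact tsub_le_tsub_left
      (CUQB.measure_iUnion_missEvent_le hM hσ hδ₀ hδ₁ hrun.adapted) 1
  · intro ω hωA i ε hε hεpos
    have hω : ∀ t z j, ω ∉ CUQB.missEvent μ₀ K₀ σ δ n h ξ x t z j := fun t z j hmem =>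
      hωA (subset_toMeasurable P B (Set.mem_iUnion.2 ⟨t, Set.mem_iUnion.2 ⟨z,
        Set.mem_iUnion.2 ⟨j, hmem⟩⟩⟩))
    have hCε : 0 < 1 / (1 + CUQB.rateConst m n N δ σ κ L) * ε := by positivity
    have hex : ∃ T : ℕ, 2 ≤ T ∧ √(Real.log T * CUQB.infoGainMax K₀ σ T / T)
        < 1 / (1 + CUQB.rateConst m n N δ σ κ L) * ε := by
      have hlim' := (Real.continuous_sqrt.tendsto 0).comp hlim
      rw [Real.sqrt_zero] at hlim'
      exact ((eventually_ge_atTop 2).and (hlim'.eventually_lt_const hCε)).exists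
    classical
    refine ⟨Nat.find hex, ⟨Nat.find_spec hex, fun T hT => Nat.find_min' hex hT⟩, fun hsol => ?_⟩
    obtain ⟨hT2, hTlt⟩ := Nat.find_spec hex
    by_contra! hnot
    have hfeas : ∀ t < Nat.find hex, ∀ i : Fin n,
        0 ≤ CUQB.runUpper μ₀ K₀ σ g δ h ξ x t ω i.succ (x t ω) := by
      intro t ht
      have hund : CUQB.Undeclared (CUQB.runUpper μ₀ K₀ σ g δ h ξ x) t ω :=
        fun s hs => hnot s (hs.trans_lt ht)
      exact (hrun.optimal t ω hund (hsol t ht hund)).1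
    have hle := CUQB.violation_le_of_undeclared hM hσ hδ₀ hδ₁ hg hκ hω hT2 hfeas i
    rw [← hε, hcard] at hle
    have h1 := hle.trans (mul_le_mul_of_nonneg_left hTlt.le hR)
    -- The bound now reads `ε (1 + R) ≤ R ε`, contradicting `ε > 0`.
    rw [one_div, inv_mul_eq_div, mul_div_assoc', le_div_iff₀ (by positivity)] at h1
    linarith
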